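/- A planar convex body is a compact convex set $\Omega\subset\mathbb R^2$ with non-empty interior. Let $c(\Omega)$ be the center of mass of $\Omega$ with respect to area, $\mathrm{length}(\partial\Omega)$ the perimeter of $\Omega$ (the one-dimensional Hausdorff measure of its boundary $\partial\Omega$), $c(\partial\Omega)$ the center of mass of $\partial\Omega$ with respect to arc length, and $\mathrm{diam}(\Omega)$ the diameter of $\Omega$, all with respect to the Euclidean norm $|\cdot|$. Then for every planar convex body $\Omega$, $$|c(\partial\Omega)-c(\Omega)|\le \tfrac16\,\mathrm{diam}(\Omega)\le \tfrac1{12}\,\mathrm{length}(\partial\Omega).$$ The constants cannot be improved: for every real $k<\tfrac16$ there is a planar convex body $\Omega$ with $|c(\partial\Omega)-c(\Omega)|>k\,\mathrm{diam}(\Omega)$, and for every real $k<\tfrac1{12}$ there is a planar convex body $\Omega$ with $|c(\partial\Omega)-c(\Omega)|>k\,\mathrm{length}(\partial\Omega)$. -/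

import Mathlib

open MeasureTheory
open scoped MeasureTheory

/-- A planar convex body: a compact convex subset of the Euclidean plane with non-empty
interior. -/
structure IsPlanarConvexBody (Ω : Set (EuclideanSpace ℝ (Fin 2))) : Prop where
  isCompact : IsCompact Ω
  convex : Convex ℝ Ω
  nonempty_interior : (interior Ω).Nonempty

/-- The center of mass of `Ω` with respect to area. -/
noncomputable def bodyCentroid (Ω : Set (EuclideanSpace ℝ (Fin 2))) : EuclideanSpace ℝ (Fin 2) :=
  (volume.real Ω)⁻¹ • ∫ x in Ω, x

/-- The length of `∂Ω`: the one-dimensional Hausdorff measure of the boundary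
(Mathlib's normalization gives a segment its Euclidean length). -/
noncomputable def boundaryLength (Ω : Set (EuclideanSpace ℝ (Fin 2))) : ℝ :=
  (Measure.hausdorffMeasure 1 : Measure (EuclideanSpace ℝ (Fin 2))).real (frontier Ω)

/-- The center of mass of the boundary `∂Ω` with respect to arc length. -/
noncomputable def boundaryCentroid (Ω : Set (EuclideanSpace ℝ (Fin 2))) :
    EuclideanSpace ℝ (Fin 2) :=
  (boundaryLength Ω)⁻¹ •
    ∫ x in frontier Ω, x ∂(Measure.hausdorffMeasure 1 : Measure (EuclideanSpace ℝ (Fin 2)))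

/-! For a unit vector u, push Lebesgue measure on the projection of Ω to the line of u onto the two
boundary graphs over it. This chord measure ν_u weighs a boundary element with unit tangent τ by
|⟨u, τ⟩| ds, so by Cauchy–Crofton its average over u is a constant multiple of arc length. Hence it
is enough to show, for each u and each e, that the ν_u-mean of ⟨e, x⟩ exceeds ⟨e, c(Ω)⟩ by at most
w/6, where w bounds the width of Ω in direction e. Taking e along c(∂Ω) - c(Ω) and w = diam Ω then
gives the first inequality.

For fixed u the claim is one-dimensional (`chord_mean_le`). Parametrise the chords orthogonal to u
by t ∈ [0, 1] and let l ≤ r be the values of ⟨e, ·⟩ at their two ends; l is convex and r concave.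
With Var f = ∫f² - (∫f)², the claim reads Var l - Var r ≤ (w/3) ∫(r - l), provided e is not parallel
to u. Reflecting and scaling the values turns it into Var r - Var l ≤ (1/3) ∫(r - l) for values in
[0, 1] (`var_concave_sub_var_convex_le`). There the chord a joining the end values of r is inserted
between l and r: a is compared with l through the centroid of the concave density a - l, which lies
in [1/3, 2/3], and r with a through the inequality ∫j² ≤ (2/3) M ∫j for the convex function j = max
r - r.

Crofton's formula is used in a finite form: a sum of K chord measures lies between (2K/π - 8) and
(2K/π + 8) times arc length (`exists_crofton`). The error disappears as K → ∞ in
`integral_inner_frontier_le`.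

The second inequality holds because ν_u is at most arc length and has total mass twice the width of
Ω in direction u. Both constants are approached by thin isosceles triangles, whose area centroid is
at 2/3 of the height while the boundary centroid tends to 1/2. -/

namespace PlanarCentroid

open Set

/-! ### Moments of concave and convex functions on the unit interval. -/

lemma concaveOn_apply {s : Set ℝ} {f : ℝ → ℝ} (hf : ConcaveOn ℝ s f) {x y a b : ℝ}
    (hx : x ∈ s) (hy : y ∈ s) (ha : 0 ≤ a) (hb : 0 ≤ b) (hab : a + b = 1) :
    a * f x + b * f y ≤ f (a * x + b * y) := by
  simpa only [smul_eq_mul] using hf.2 hx hy ha hb hab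

lemma convexOn_apply {s : Set ℝ} {f : ℝ → ℝ} (hf : ConvexOn ℝ s f) {x y a b : ℝ}
    (hx : x ∈ s) (hy : y ∈ s) (ha : 0 ≤ a) (hb : 0 ≤ b) (hab : a + b = 1) :
    f (a * x + b * y) ≤ a * f x + b * f y := by
  simpa only [smul_eq_mul] using hf.2 hx hy ha hb hab

/-- The centroid of a nonnegative concave density on the unit interval is at most `2 / 3`. -/
lemma integral_mul_le_of_concaveOn {δ : ℝ → ℝ} (hδ : ConcaveOn ℝ (Icc 0 1) δ)
    (hc : ContinuousOn δ (Icc 0 1)) (h0 : ∀ t ∈ Icc (0 : ℝ) 1, 0 ≤ δ t) :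
    ∫ t in (0 : ℝ)..1, t * δ t ≤ (2 / 3) * ∫ t in (0 : ℝ)..1, δ t := by
  have huI : uIcc (0 : ℝ) 1 = Icc 0 1 := uIcc_of_le zero_le_one
  -- The line through the origin and (2/3, δ(2/3)) is below δ before 2/3 and above it afterwards,
  -- because δ 0 ≥ 0. The weight 2/3 - t changes sign at the same point, and it annihilates
  -- multiples of t (`e1`).
  have key : ∫ t in (0 : ℝ)..1, (2 / 3 - t) * (3 * t / 2 * δ (2 / 3)) ≤
      ∫ t in (0 : ℝ)..1, (2 / 3 - t) * δ t := by
    apply intervalIntegral.integral_mono_on zero_le_one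
    · exact Continuous.intervalIntegrable (by fun_prop) _ _
    · apply ContinuousOn.intervalIntegrable
      rw [huI]
      exact (by fun_prop : Continuous fun t : ℝ => 2 / 3 - t).continuousOn.mul hc
    · intro t ht
      rcases le_total t (2 / 3) with h | h
      · have := concaveOn_apply hδ (x := 0) (y := 2 / 3) (by simp) (by norm_num) (a := 1 - 3 * t / 2)
          (b := 3 * t / 2) (by linarith) (by linarith [ht.1]) (by ring)
        rw [show (1 - 3 * t / 2) * 0 + 3 * t / 2 * (2 / 3) = t by ring] at this
        have h00 := mul_nonneg (by linarith : 0 ≤ 1 - 3 * t / 2) (h0 0 (by simp))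
        exact mul_le_mul_of_nonneg_left (by linarith) (by linarith)
      · have htp : 0 < t := by linarith
        have := concaveOn_apply hδ (x := 0) (y := t) (by simp) ht (a := 1 - 2 / (3 * t))
          (b := 2 / (3 * t)) (by rw [sub_nonneg, div_le_one (by linarith)]; linarith)
          (by positivity) (by ring)
        rw [show (1 - 2 / (3 * t)) * 0 + 2 / (3 * t) * t = 2 / 3 by field_simp; ring] at this
        have h00 : 0 ≤ (1 - 2 / (3 * t)) * δ 0 := mul_nonneg
          (by rw [sub_nonneg, div_le_one (by linarith)]; linarith) (h0 0 (by simp))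
        have h2 : 2 / (3 * t) * δ t ≤ δ (2 / 3) := by linarith
        have h3 : δ t ≤ 3 * t / 2 * δ (2 / 3) := by
          calc δ t = 3 * t / 2 * (2 / (3 * t) * δ t) := by field_simp
            _ ≤ _ := mul_le_mul_of_nonneg_left h2 (by linarith)
        exact mul_le_mul_of_nonpos_left h3 (by linarith)
  have e1 : ∫ t in (0 : ℝ)..1, (2 / 3 - t) * (3 * t / 2 * δ (2 / 3)) = 0 := by
    have : (fun t : ℝ => (2 / 3 - t) * (3 * t / 2 * δ (2 / 3))) =
        fun t => δ (2 / 3) * (t - 3 / 2 * t ^ 2) := by ext t; ring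
    rw [this, intervalIntegral.integral_const_mul, intervalIntegral.integral_sub
      (Continuous.intervalIntegrable (by fun_prop) _ _)
      (Continuous.intervalIntegrable (by fun_prop) _ _), intervalIntegral.integral_const_mul,
      integral_id, integral_pow]
    norm_num
  have e2 : ∫ t in (0 : ℝ)..1, (2 / 3 - t) * δ t =
      (2 / 3) * (∫ t in (0 : ℝ)..1, δ t) - ∫ t in (0 : ℝ)..1, t * δ t := by
    rw [← intervalIntegral.integral_const_mul, ← intervalIntegral.integral_sub]
    · congr 1; ext t; ring
    · exact (ContinuousOn.intervalIntegrable (by rw [huI]; exact hc)).const_mul _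
    · apply ContinuousOn.intervalIntegrable
      rw [huI]; exact continuousOn_id.mul hc
  linarith

/-- The upper bound applied to the reflected density t ↦ δ(1 - t). -/
lemma le_integral_mul_of_concaveOn {δ : ℝ → ℝ} (hδ : ConcaveOn ℝ (Icc 0 1) δ)
    (hc : ContinuousOn δ (Icc 0 1)) (h0 : ∀ t ∈ Icc (0 : ℝ) 1, 0 ≤ δ t) :
    (1 / 3) * ∫ t in (0 : ℝ)..1, δ t ≤ ∫ t in (0 : ℝ)..1, t * δ t := by
  have huI : uIcc (0 : ℝ) 1 = Icc 0 1 := uIcc_of_le zero_le_one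
  have hm : MapsTo (fun t : ℝ => 1 - t) (Icc 0 1) (Icc 0 1) := fun t ht =>
    ⟨by linarith [ht.2], by linarith [ht.1]⟩
  have hc' : ContinuousOn (fun t => δ (1 - t)) (Icc 0 1) :=
    hc.comp (by fun_prop : Continuous fun t : ℝ => 1 - t).continuousOn hm
  have := integral_mul_le_of_concaveOn (δ := fun t => δ (1 - t)) ⟨convex_Icc 0 1, ?_⟩ hc'
    (fun t ht => h0 _ (hm ht))
  · have e1 : ∫ t in (0 : ℝ)..1, δ (1 - t) = ∫ t in (0 : ℝ)..1, δ t := by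
      rw [intervalIntegral.integral_comp_sub_left (fun t => δ t)]; norm_num
    have e2 : ∫ t in (0 : ℝ)..1, t * δ (1 - t) = ∫ t in (0 : ℝ)..1, (1 - t) * δ t := by
      have := intervalIntegral.integral_comp_sub_left (a := 0) (b := 1)
        (fun t => (1 - t) * δ t) 1
      simp only [sub_sub_cancel, sub_self, sub_zero] at this
      exact this
    have e3 : ∫ t in (0 : ℝ)..1, (1 - t) * δ t =
      (∫ t in (0 : ℝ)..1, δ t) - ∫ t in (0 : ℝ)..1, t * δ t := by
      rw [← intervalIntegral.integral_sub]
      · congr 1; ext t; ring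
      · exact (ContinuousOn.intervalIntegrable (by rw [huI]; exact hc))
      · apply ContinuousOn.intervalIntegrable
        rw [huI]; exact continuousOn_id.mul hc
    rw [e2, e3, e1] at this
    linarith
  · intro x hx y hy p q hp hq hpq
    have := hδ.2 (hm hx) (hm hy) hp hq hpq
    simp only [smul_eq_mul] at this ⊢
    convert this using 2
    linear_combination (-1 : ℝ) * hpq

/-- A convex function on the unit interval vanishing at the left end is monotone in the strong
sense of lying below its chords from the origin. -/
lemma convexOn_le_mul {j : ℝ → ℝ} (hj : ConvexOn ℝ (Icc 0 1) j) (hz : j 0 = 0)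
    {x y : ℝ} (hx : 0 ≤ x) (hxy : x ≤ y) (hy : y ≤ 1) (hy0 : 0 < y) : j x ≤ x / y * j y := by
  have := convexOn_apply hj (x := 0) (y := y) (by simp) ⟨hy0.le, hy⟩ (a := 1 - x / y) (b := x / y)
    (by rw [sub_nonneg, div_le_one hy0]; exact hxy) (by positivity) (by ring)
  simp only [mul_zero, zero_add, hz] at this
  rwa [div_mul_cancel₀ _ hy0.ne'] at this

lemma integral_le_half_of_convexOn {j : ℝ → ℝ} {M : ℝ} (hj : ConvexOn ℝ (Icc 0 1) j)
    (hc : ContinuousOn j (Icc 0 1)) (hz : j 0 = 0) (hM : j 1 ≤ M) :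
    ∫ t in (0 : ℝ)..1, j t ≤ M / 2 := by
  have huI : uIcc (0 : ℝ) 1 = Icc 0 1 := uIcc_of_le zero_le_one
  have : ∫ t in (0 : ℝ)..1, j t ≤ ∫ t in (0 : ℝ)..1, t * M := by
    apply intervalIntegral.integral_mono_on zero_le_one
    · exact ContinuousOn.intervalIntegrable (by rw [huI]; exact hc)
    · exact Continuous.intervalIntegrable (by fun_prop) _ _
    · intro t ht
      have := convexOn_le_mul hj hz ht.1 ht.2 le_rfl one_pos
      rw [div_one] at this
      exact this.trans (mul_le_mul_of_nonneg_left hM ht.1)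
  rw [intervalIntegral.integral_mul_const, integral_id] at this
  linarith

/-- Integrals of the ramp `max 0 (M * (1 - (1 - t) / c))` and of its square. -/
lemma integral_ramp {M c : ℝ} (hM : 0 < M) (hc : 0 < c) (hc1 : c ≤ 1) :
    ∫ t in (0 : ℝ)..1, max 0 (M * (1 - (1 - t) / c)) = M * c / 2 ∧
    ∫ t in (0 : ℝ)..1, (max 0 (M * (1 - (1 - t) / c))) ^ 2 = M ^ 2 * c / 3 := by
  have hcont : Continuous fun t : ℝ => max 0 (M * (1 - (1 - t) / c)) := by fun_prop
  have hneg : ∀ t, t ≤ 1 - c → max 0 (M * (1 - (1 - t) / c)) = 0 := fun t ht => by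
    apply max_eq_left
    apply mul_nonpos_of_nonneg_of_nonpos hM.le
    rw [sub_nonpos, le_div_iff₀ hc]; linarith
  have hpos : ∀ t, 1 - c ≤ t → max 0 (M * (1 - (1 - t) / c)) = M / c * (t - (1 - c)) :=
    fun t ht => by
    rw [max_eq_right]
    · field_simp; ring
    · apply mul_nonneg hM.le
      rw [sub_nonneg, div_le_iff₀ hc]; linarith
  have h1 : ∀ n : ℕ, n ≠ 0 → ∫ t in (0 : ℝ)..1, (max 0 (M * (1 - (1 - t) / c))) ^ n =
      ∫ t in (1 - c)..1, (M / c * (t - (1 - c))) ^ n := fun n hn => by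
    rw [← intervalIntegral.integral_add_adjacent_intervals (b := 1 - c)
      (Continuous.intervalIntegrable (by fun_prop) _ _)
      (Continuous.intervalIntegrable (by fun_prop) _ _)]
    have z : ∫ t in (0 : ℝ)..(1 - c), (max 0 (M * (1 - (1 - t) / c))) ^ n = 0 := by
      rw [intervalIntegral.integral_congr (g := fun _ => 0)]
      · simp
      · intro t ht
        rw [uIcc_of_le (by linarith)] at ht
        simp only [hneg t ht.2]
        exact zero_pow hn
    rw [z, zero_add]
    apply intervalIntegral.integral_congr
    intro t ht
    rw [uIcc_of_le (by linarith)] at ht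
    simp only [hpos t ht.1]
  have h2 : ∀ n : ℕ, ∫ t in (1 - c)..1, (M / c * (t - (1 - c))) ^ n =
      (M / c) ^ n * (c ^ (n + 1) / (n + 1)) := fun n => by
    simp_rw [mul_pow]
    rw [intervalIntegral.integral_const_mul,
      intervalIntegral.integral_comp_sub_right (fun t => t ^ n), integral_pow]
    simp
  constructor
  · have := h1 1 one_ne_zero
    simp only [pow_one] at this
    rw [this]
    have := h2 1
    simp only [pow_one] at this
    rw [this]; field_simp; norm_num
  · rw [h1 2 two_ne_zero, h2 2]; field_simp; norm_num

/-- Among such functions with a given integral, the second moment is largest for a ramp that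
vanishes and then rises linearly to M at 1. A convex j crosses the ramp of equal integral only once,
from above to below, and this orders the integrals of the squares. -/
lemma integral_sq_le_of_convexOn {j : ℝ → ℝ} {M : ℝ} (hj : ConvexOn ℝ (Icc 0 1) j)
    (hc : ContinuousOn j (Icc 0 1)) (hz : j 0 = 0) (h0 : ∀ t ∈ Icc (0 : ℝ) 1, 0 ≤ j t)
    (hM : ∀ t ∈ Icc (0 : ℝ) 1, j t ≤ M) :
    ∫ t in (0 : ℝ)..1, j t ^ 2 ≤ 2 / 3 * M * ∫ t in (0 : ℝ)..1, j t := by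
  have huI : uIcc (0 : ℝ) 1 = Icc 0 1 := uIcc_of_le zero_le_one
  have hint : IntervalIntegrable j volume 0 1 :=
    ContinuousOn.intervalIntegrable (by rw [huI]; exact hc)
  have hint2 : IntervalIntegrable (fun t => j t ^ 2) volume 0 1 :=
    ContinuousOn.intervalIntegrable (by rw [huI]; exact hc.pow 2)
  have hI0 : 0 ≤ ∫ t in (0 : ℝ)..1, j t :=
    intervalIntegral.integral_nonneg zero_le_one h0
  have hM0 : 0 ≤ M := (h0 0 (by simp)).trans (hM 0 (by simp))
  have hhalf := integral_le_half_of_convexOn hj hc hz (hM 1 (by simp))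
  set I := ∫ t in (0 : ℝ)..1, j t with hI
  -- If the integral vanishes there is no ramp (its base would have length 0), and j² ≤ M j
  -- suffices.
  rcases hI0.eq_or_lt with hI1 | hI1
  · have : ∫ t in (0 : ℝ)..1, j t ^ 2 ≤ ∫ t in (0 : ℝ)..1, M * j t := by
      apply intervalIntegral.integral_mono_on zero_le_one hint2 (hint.const_mul _)
      intro t ht
      rw [sq]
      exact mul_le_mul_of_nonneg_right (hM t ht) (h0 t ht)
    rw [intervalIntegral.integral_const_mul, ← hI, ← hI1] at this
    rw [← hI1]; linarith
  have hMp : 0 < M := by linarith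
  -- The base length for which the ramp has the same integral as j.
  set c := 2 * I / M with hcdef
  have hcp : 0 < c := by positivity
  have hc1 : c ≤ 1 := by rw [hcdef, div_le_one hMp]; linarith
  obtain ⟨r1, r2⟩ := integral_ramp hMp hcp hc1
  set ℓ : ℝ → ℝ := fun t => M * (1 - (1 - t) / c) with hℓ
  set S : Set ℝ := {t | t ∈ Icc (0 : ℝ) 1 ∧ j t ≤ ℓ t} with hS
  have h1S : (1 : ℝ) ∈ S := ⟨by simp, by simpa [hℓ] using hM 1 (by simp)⟩
  have hSb : BddBelow S := ⟨0, fun t ht => ht.1.1⟩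
  have hScl : IsClosed S := by
    have hcl : Continuous ℓ := by fun_prop
    exact isClosed_Icc.isClosed_le hc hcl.continuousOn
  -- The crossing point: j exceeds the line ℓ before y, and by convexity stays below it on [y, 1].
  set y := sInf S with hy
  have hyS : y ∈ S := hScl.csInf_mem ⟨1, h1S⟩ hSb
  have hmono : ∀ s t, 0 ≤ s → s ≤ t → t ≤ 1 → j s ≤ j t := by
    intro s t hs hst ht
    rcases (hs.trans hst).eq_or_lt with h | h
    · rw [show s = t by linarith]
    · have := convexOn_le_mul hj hz hs hst ht h
      have h2 : s / t * j t ≤ 1 * j t :=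
        mul_le_mul_of_nonneg_right ((div_le_one h).2 hst) (h0 t ⟨h.le, ht⟩)
      linarith
  -- Since j and the ramp are monotone, both factors of (ramp - j)((ramp - j y) + (j - j y)) have
  -- the same sign on each side of y. After integration the term with 2 j(y) drops out, the two
  -- integrals being equal.
  have hpt : ∀ t ∈ Icc (0 : ℝ) 1,
      0 ≤ (max 0 (ℓ t)) ^ 2 - j t ^ 2 - 2 * j y * (max 0 (ℓ t) - j t) := by
    intro t ht
    have : (max 0 (ℓ t)) ^ 2 - j t ^ 2 - 2 * j y * (max 0 (ℓ t) - j t) =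
      (max 0 (ℓ t) - j t) * ((max 0 (ℓ t) - j y) + (j t - j y)) := by ring
    rw [this]
    rcases lt_or_ge t y with hty | hty
    · have h1 : ℓ t < j t := by
        by_contra hcon
        exact absurd (csInf_le hSb ⟨ht, not_lt.1 hcon⟩) (not_le.2 hty)
      have h2 : max 0 (ℓ t) ≤ j t := max_le (h0 t ht) h1.le
      have h3 := hmono t y ht.1 hty.le hyS.1.2
      exact mul_nonneg_of_nonpos_of_nonpos (by linarith) (by linarith)
    · have h1 : j t ≤ ℓ t := by
        rcases hyS.1.2.eq_or_lt with h | h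
        · have : t = 1 := le_antisymm ht.2 (h ▸ hty)
          rw [this]; exact h1S.2
        · have hd : 0 < 1 - y := by linarith
          have := convexOn_apply hj hyS.1 h1S.1 (a := (1 - t) / (1 - y)) (b := (t - y) / (1 - y))
            (div_nonneg (by linarith [ht.2]) hd.le) (div_nonneg (by linarith) hd.le)
            (by field_simp; ring)
          rw [show (1 - t) / (1 - y) * y + (t - y) / (1 - y) * 1 = t by field_simp; ring] at this
          refine this.trans ?_
          have ha : 0 ≤ (1 - t) / (1 - y) := div_nonneg (by linarith [ht.2]) hd.le
          have hb : 0 ≤ (t - y) / (1 - y) := div_nonneg (by linarith) hd.le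
          calc _ ≤ (1 - t) / (1 - y) * ℓ y + (t - y) / (1 - y) * ℓ 1 :=
                add_le_add (mul_le_mul_of_nonneg_left hyS.2 ha)
                  (mul_le_mul_of_nonneg_left h1S.2 hb)
            _ = ℓ t := by simp only [hℓ]; field_simp; ring
      have h2 := h1.trans (le_max_right 0 (ℓ t))
      have h3 := hmono y t hyS.1.1 hty ht.2
      exact mul_nonneg (by linarith) (by linarith)
  have hint3 : IntervalIntegrable (fun t => max 0 (ℓ t)) volume 0 1 :=
    Continuous.intervalIntegrable (by fun_prop) _ _
  have hint4 : IntervalIntegrable (fun t => (max 0 (ℓ t)) ^ 2) volume 0 1 :=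
    Continuous.intervalIntegrable (by fun_prop) _ _
  have hfin := intervalIntegral.integral_nonneg (μ := volume) zero_le_one hpt
  rw [intervalIntegral.integral_sub (hint4.sub hint2) ((hint3.sub hint).const_mul _),
    intervalIntegral.integral_sub hint4 hint2, intervalIntegral.integral_const_mul,
    intervalIntegral.integral_sub hint3 hint, r1, r2, ← hI] at hfin
  have e1 : M * c / 2 = I := by rw [hcdef]; field_simp
  have e2 : M ^ 2 * c / 3 = 2 / 3 * M * I := by rw [hcdef]; field_simp
  rw [e1, e2] at hfin
  linarith

/-! ### Affine changes of variable. -/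

lemma mapsTo_affine_Icc {a b z w : ℝ} (hz : z ∈ Icc a b) (hw : w ∈ Icc a b) :
    MapsTo (fun s : ℝ => z + (w - z) * s) (Icc 0 1) (Icc a b) := by
  intro s hs
  have := (convex_Icc a b) hz hw (sub_nonneg.2 hs.2) hs.1 (by ring)
  simp only [smul_eq_mul] at this
  convert this using 1
  ring

lemma convexOn_comp_affine {a b z w : ℝ} {f : ℝ → ℝ} (hf : ConvexOn ℝ (Icc a b) f)
    (hz : z ∈ Icc a b) (hw : w ∈ Icc a b) :
    ConvexOn ℝ (Icc 0 1) fun s => f (z + (w - z) * s) := by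
  refine ⟨convex_Icc 0 1, fun x hx y hy p q hp hq hpq => ?_⟩
  have := hf.2 (mapsTo_affine_Icc hz hw hx) (mapsTo_affine_Icc hz hw hy) hp hq hpq
  simp only [smul_eq_mul] at this ⊢
  convert this using 2
  linear_combination (-z) * hpq

lemma concaveOn_comp_affine {a b z w : ℝ} {f : ℝ → ℝ} (hf : ConcaveOn ℝ (Icc a b) f)
    (hz : z ∈ Icc a b) (hw : w ∈ Icc a b) :
    ConcaveOn ℝ (Icc 0 1) fun s => f (z + (w - z) * s) := by
  rw [← neg_convexOn_iff] at hf ⊢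
  exact convexOn_comp_affine hf hz hw

lemma continuousOn_comp_affine {a b z w : ℝ} {f : ℝ → ℝ} (hf : ContinuousOn f (Icc a b))
    (hz : z ∈ Icc a b) (hw : w ∈ Icc a b) :
    ContinuousOn (fun s => f (z + (w - z) * s)) (Icc 0 1) :=
  hf.comp (by fun_prop : Continuous fun s : ℝ => z + (w - z) * s).continuousOn
    (mapsTo_affine_Icc hz hw)

lemma integral_eq_comp_affine (f : ℝ → ℝ) (z w : ℝ) :
    ∫ t in z..w, f t = (w - z) * ∫ s in (0 : ℝ)..1, f (z + (w - z) * s) := by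
  have := intervalIntegral.smul_integral_comp_add_mul (a := 0) (b := 1) f (w - z) z
  simp only [smul_eq_mul, mul_zero, add_zero, mul_one, add_sub_cancel] at this
  exact this.symm

lemma intervalIntegrable_of_continuousOn {f : ℝ → ℝ} (hf : ContinuousOn f (Icc 0 1)) :
    IntervalIntegrable f volume 0 1 :=
  ContinuousOn.intervalIntegrable (by rwa [uIcc_of_le zero_le_one])

lemma continuousOn_sq {f : ℝ → ℝ} {s : Set ℝ} (hf : ContinuousOn f s) :
    ContinuousOn (fun t => f t ^ 2) s := hf.pow 2

/-- The zero z cuts the interval into two pieces; each is rescaled to [0, 1] with z at 0, and both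
bounds are stable under the weighted sum with weights z and 1 - z. -/
lemma integral_bounds_of_convexOn {j : ℝ → ℝ} {M z : ℝ} (hj : ConvexOn ℝ (Icc 0 1) j)
    (hc : ContinuousOn j (Icc 0 1)) (hz : z ∈ Icc (0 : ℝ) 1) (hjz : j z = 0)
    (h0 : ∀ t ∈ Icc (0 : ℝ) 1, 0 ≤ j t) (hM : ∀ t ∈ Icc (0 : ℝ) 1, j t ≤ M) :
    ∫ t in (0 : ℝ)..1, j t ≤ M / 2 ∧
    ∫ t in (0 : ℝ)..1, j t ^ 2 ≤ 2 / 3 * M * ∫ t in (0 : ℝ)..1, j t := by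
  have side : ∀ w ∈ Icc (0 : ℝ) 1, (∫ s in (0 : ℝ)..1, j (z + (w - z) * s) ≤ M / 2) ∧
      (∫ s in (0 : ℝ)..1, j (z + (w - z) * s) ^ 2 ≤
        2 / 3 * M * ∫ s in (0 : ℝ)..1, j (z + (w - z) * s)) := fun w hw => by
    have hm := mapsTo_affine_Icc hz hw
    constructor
    · exact integral_le_half_of_convexOn (convexOn_comp_affine hj hz hw)
        (continuousOn_comp_affine hc hz hw) (by simpa using hjz) (hM _ (hm (by simp)))
    · exact integral_sq_le_of_convexOn (convexOn_comp_affine hj hz hw)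
        (continuousOn_comp_affine hc hz hw) (by simpa using hjz) (fun t ht => h0 _ (hm ht))
        (fun t ht => hM _ (hm ht))
  have split : ∀ f : ℝ → ℝ, ContinuousOn f (Icc 0 1) → ∫ t in (0 : ℝ)..1, f t =
      z * (∫ s in (0 : ℝ)..1, f (z + (0 - z) * s)) +
      (1 - z) * ∫ s in (0 : ℝ)..1, f (z + (1 - z) * s) := fun f hf => by
    have hsub : ∀ a b, a ∈ Icc (0 : ℝ) 1 → b ∈ Icc (0 : ℝ) 1 →
        IntervalIntegrable f volume a b := fun a b ha hb =>
      (hf.mono (uIcc_subset_Icc ha hb)).intervalIntegrable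
    rw [← intervalIntegral.integral_add_adjacent_intervals (hsub 0 z (by simp) hz)
      (hsub z 1 hz (by simp)), intervalIntegral.integral_symm, integral_eq_comp_affine f z 0,
      integral_eq_comp_affine f z 1]
    ring
  obtain ⟨a1, a2⟩ := side 0 (by simp)
  obtain ⟨b1, b2⟩ := side 1 (by simp)
  rw [split j hc, split _ (continuousOn_sq hc)]
  have hz1 : 0 ≤ 1 - z := sub_nonneg.2 hz.2
  constructor
  · nlinarith [mul_le_mul_of_nonneg_left a1 hz.1, mul_le_mul_of_nonneg_left b1 hz1]
  · nlinarith [mul_le_mul_of_nonneg_left a2 hz.1, mul_le_mul_of_nonneg_left b2 hz1]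

/-! ### Comparison of variances. -/

lemma sq_integral_le {f : ℝ → ℝ} (hf : ContinuousOn f (Icc 0 1)) :
    (∫ t in (0 : ℝ)..1, f t) ^ 2 ≤ ∫ t in (0 : ℝ)..1, f t ^ 2 := by
  set I := ∫ t in (0 : ℝ)..1, f t with hI
  have h1 := intervalIntegrable_of_continuousOn hf
  have h2 := intervalIntegrable_of_continuousOn (continuousOn_sq hf)
  have h : 0 ≤ ∫ t in (0 : ℝ)..1, (f t - I) ^ 2 :=
    intervalIntegral.integral_nonneg zero_le_one fun _ _ => sq_nonneg _
  have e : (fun t => (f t - I) ^ 2) = fun t => f t ^ 2 - 2 * I * f t + I ^ 2 := by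
    ext t; ring
  rw [e, intervalIntegral.integral_add (h2.sub (h1.const_mul _)) (by simp),
    intervalIntegral.integral_sub h2 (h1.const_mul _), intervalIntegral.integral_const_mul,
    ← hI] at h
  simp only [intervalIntegral.integral_const, sub_zero, smul_eq_mul] at h
  linarith

lemma integral_affine (p s : ℝ) : ∫ t in (0 : ℝ)..1, (p + s * t) = p + s / 2 := by
  rw [intervalIntegral.integral_add (by simp) (Continuous.intervalIntegrable (by fun_prop) _ _),
    intervalIntegral.integral_const_mul, integral_id]
  simp; ring

lemma integral_affine_sq (p s : ℝ) :
    ∫ t in (0 : ℝ)..1, (p + s * t) ^ 2 = p ^ 2 + p * s + s ^ 2 / 3 := by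
  have e : (fun t : ℝ => (p + s * t) ^ 2) = fun t => (p ^ 2 + 2 * p * s * t) + s ^ 2 * t ^ 2 := by
    ext t; ring
  rw [e, intervalIntegral.integral_add (Continuous.intervalIntegrable (by fun_prop) _ _)
    (Continuous.intervalIntegrable (by fun_prop) _ _), integral_affine,
    intervalIntegral.integral_const_mul, integral_pow]
  norm_num; ring

/-- An affine function above a convex one: its variance exceeds the other one by at most a third
of the difference of the means. -/
lemma var_affine_sub_var_convex_le {l : ℝ → ℝ} {p s : ℝ} (hl : ConvexOn ℝ (Icc 0 1) l)
    (hlc : ContinuousOn l (Icc 0 1)) (hle : ∀ t ∈ Icc (0 : ℝ) 1, l t ≤ p + s * t)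
    (hs : |s| ≤ 1) :
    s ^ 2 / 12 - ((∫ t in (0 : ℝ)..1, l t ^ 2) - (∫ t in (0 : ℝ)..1, l t) ^ 2) ≤
      1 / 3 * (p + s / 2 - ∫ t in (0 : ℝ)..1, l t) := by
  -- Expanding Var(a - δ) for the affine function a gives Var a - Var l = 2 s Cov(t, δ) - Var δ.
  -- Here Var δ ≥ 0, and |Cov(t, δ)| ≤ (∫δ)/6 because the centroid of the concave density δ lies in
  -- [1/3, 2/3].
  set δ : ℝ → ℝ := fun t => p + s * t - l t with hδ
  have haff : ConcaveOn ℝ (Icc (0 : ℝ) 1) fun t => p + s * t :=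
    ⟨convex_Icc 0 1, fun x _ y _ a b _ _ hab => by
      simp only [smul_eq_mul]; apply le_of_eq; linear_combination p * hab⟩
  have hδc : ConcaveOn ℝ (Icc 0 1) δ := haff.sub hl
  have hδcont : ContinuousOn δ (Icc 0 1) :=
    (by fun_prop : Continuous fun t : ℝ => p + s * t).continuousOn.sub hlc
  have hδ0 : ∀ t ∈ Icc (0 : ℝ) 1, 0 ≤ δ t := fun t ht => sub_nonneg.2 (hle t ht)
  have c1 := integral_mul_le_of_concaveOn hδc hδcont hδ0
  have c2 := le_integral_mul_of_concaveOn hδc hδcont hδ0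
  have c3 := sq_integral_le hδcont
  have c4 : 0 ≤ ∫ t in (0 : ℝ)..1, δ t := intervalIntegral.integral_nonneg zero_le_one hδ0
  have iδ := intervalIntegrable_of_continuousOn hδcont
  have iδ2 := intervalIntegrable_of_continuousOn (continuousOn_sq hδcont)
  have itδ : IntervalIntegrable (fun t => t * δ t) volume 0 1 :=
    intervalIntegrable_of_continuousOn (continuousOn_id.mul hδcont)
  have ia : IntervalIntegrable (fun t => p + s * t) volume 0 1 :=
    Continuous.intervalIntegrable (by fun_prop) _ _
  have ia2 : IntervalIntegrable (fun t => (p + s * t) ^ 2) volume 0 1 :=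
    Continuous.intervalIntegrable (by fun_prop) _ _
  have e1 : ∫ t in (0 : ℝ)..1, l t = p + s / 2 - ∫ t in (0 : ℝ)..1, δ t := by
    rw [← integral_affine, ← intervalIntegral.integral_sub ia iδ]
    congr 1; ext t; simp [hδ]
  have e2 : ∫ t in (0 : ℝ)..1, l t ^ 2 = p ^ 2 + p * s + s ^ 2 / 3 -
      (2 * p * (∫ t in (0 : ℝ)..1, δ t) + 2 * s * ∫ t in (0 : ℝ)..1, t * δ t) +
      ∫ t in (0 : ℝ)..1, δ t ^ 2 := by
    have i3 := (iδ.const_mul (2 * p)).add (itδ.const_mul (2 * s))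
    rw [← integral_affine_sq, ← intervalIntegral.integral_const_mul,
      ← intervalIntegral.integral_const_mul, ← intervalIntegral.integral_add
      (iδ.const_mul _) (itδ.const_mul _), ← intervalIntegral.integral_sub ia2 i3,
      ← intervalIntegral.integral_add (ia2.sub i3) iδ2]
    congr 1; ext t; simp only [hδ]; ring
  rw [e1, e2]
  set D := ∫ t in (0 : ℝ)..1, δ t
  set T := ∫ t in (0 : ℝ)..1, t * δ t
  have h1 : |T - D / 2| ≤ D / 6 := by rw [abs_le]; constructor <;> linarith
  have h2 : s * (T - D / 2) ≤ D / 6 := by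
    calc s * (T - D / 2) ≤ |s * (T - D / 2)| := le_abs_self _
      _ = |s| * |T - D / 2| := abs_mul _ _
      _ ≤ 1 * (D / 6) := mul_le_mul hs h1 (abs_nonneg _) zero_le_one
      _ = _ := one_mul _
  nlinarith

/-- A concave function with values in `[0, 1]` compared with the chord joining its end values. -/
lemma var_concave_sub_var_chord_le {r : ℝ → ℝ} (hr : ConcaveOn ℝ (Icc 0 1) r)
    (hrc : ContinuousOn r (Icc 0 1)) (h0 : ∀ t ∈ Icc (0 : ℝ) 1, 0 ≤ r t)
    (h1 : ∀ t ∈ Icc (0 : ℝ) 1, r t ≤ 1) :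
    (∫ t in (0 : ℝ)..1, r t ^ 2) - (∫ t in (0 : ℝ)..1, r t) ^ 2 - (r 1 - r 0) ^ 2 / 12 ≤
      1 / 3 * ((∫ t in (0 : ℝ)..1, r t) - (r 0 + r 1) / 2) := by
  obtain ⟨z, hz, hzmax⟩ := isCompact_Icc.exists_isMaxOn (nonempty_Icc.2 zero_le_one) hrc
  set M := r z with hM
  have hmax : ∀ t ∈ Icc (0 : ℝ) 1, r t ≤ M := fun t ht => hzmax ht
  set μ := min (r 0) (r 1) with hμ
  have hmin : ∀ t ∈ Icc (0 : ℝ) 1, μ ≤ r t := fun t ht => by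
    have := concaveOn_apply hr (x := 0) (y := 1) (a := 1 - t) (b := t) (by simp) (by simp)
      (by linarith [ht.2]) ht.1 (by ring)
    simp only [mul_zero, zero_add, mul_one] at this
    have a1 := mul_le_mul_of_nonneg_left (min_le_left (r 0) (r 1)) (sub_nonneg.2 ht.2)
    have a2 := mul_le_mul_of_nonneg_left (min_le_right (r 0) (r 1)) ht.1
    nlinarith
  -- The variance of r equals that of j, which is convex, nonnegative and zero at the maximum point
  -- z.
  set j : ℝ → ℝ := fun t => M - r t with hj
  have hjc : ConvexOn ℝ (Icc 0 1) j := (convexOn_const M (convex_Icc 0 1)).sub hr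
  have hjcont : ContinuousOn j (Icc 0 1) := continuousOn_const.sub hrc
  obtain ⟨b1, b2⟩ := integral_bounds_of_convexOn (M := M - μ) hjc hjcont hz (by simp [hj, hM])
    (fun t ht => sub_nonneg.2 (hmax t ht)) (fun t ht => sub_le_sub_left (hmin t ht) _)
  have ij := intervalIntegrable_of_continuousOn hjcont
  have ij2 := intervalIntegrable_of_continuousOn (continuousOn_sq hjcont)
  have e1 : ∫ t in (0 : ℝ)..1, r t = M - ∫ t in (0 : ℝ)..1, j t := by
    have : M = ∫ t in (0 : ℝ)..1, M := by simp
    nth_rw 1 [this]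
    rw [← intervalIntegral.integral_sub (by simp) ij]
    congr 1; ext t; simp [hj]
  have e2 : ∫ t in (0 : ℝ)..1, r t ^ 2 = M ^ 2 - 2 * M * (∫ t in (0 : ℝ)..1, j t) +
      ∫ t in (0 : ℝ)..1, j t ^ 2 := by
    have : M ^ 2 = ∫ t in (0 : ℝ)..1, M ^ 2 := by simp
    nth_rw 1 [this]
    rw [← intervalIntegral.integral_const_mul, ← intervalIntegral.integral_sub (by simp)
      (ij.const_mul _), ← intervalIntegral.integral_add (intervalIntegrable_const.sub
      (ij.const_mul _)) ij2]
    congr 1; ext t; simp only [hj]; ring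
  rw [e1, e2]
  set e := ∫ t in (0 : ℝ)..1, j t
  have hs : ∃ s, 0 ≤ s ∧ (r 1 - r 0) ^ 2 = s ^ 2 ∧ r 0 + r 1 = 2 * μ + s ∧ s ≤ M - μ := by
    have m0 := hmax 0 (by simp)
    have m1 := hmax 1 (by simp)
    rcases le_total (r 0) (r 1) with h | h
    · exact ⟨r 1 - r 0, by linarith, rfl, by rw [hμ, min_eq_left h]; ring,
        by rw [hμ, min_eq_left h]; linarith⟩
    · exact ⟨r 0 - r 1, by linarith, by ring, by rw [hμ, min_eq_right h]; ring,
        by rw [hμ, min_eq_right h]; linarith⟩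
  obtain ⟨s, hs0, hs1, hs2, hs3⟩ := hs
  have hμ0 : 0 ≤ μ := le_min (h0 0 (by simp)) (h0 1 (by simp))
  have hM1 : M ≤ 1 := h1 z hz
  rw [hs1, hs2]
  set N := M - μ with hN
  -- Once ∫j² is replaced by its bound (2/3) N e, the right side minus the left is exactly q1/12 +
  -- q2/3 + q3.
  have q1 : 0 ≤ (N - s) * (2 - N - s) := mul_nonneg (by linarith) (by linarith)
  have q2 : 0 ≤ (N / 2 - e) * (1 - N) := mul_nonneg (by linarith) (by linarith)
  have q3 := sq_nonneg (N / 2 - e)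
  rw [show M = N + μ by ring]
  nlinarith

/-- The chord joining the end values of r lies between l and r, so the two comparisons add up and
the terms of the chord cancel. -/
lemma var_concave_sub_var_convex_le {l r : ℝ → ℝ} (hr : ConcaveOn ℝ (Icc 0 1) r)
    (hl : ConvexOn ℝ (Icc 0 1) l) (hrc : ContinuousOn r (Icc 0 1))
    (hlc : ContinuousOn l (Icc 0 1)) (h0 : ∀ t ∈ Icc (0 : ℝ) 1, 0 ≤ l t)
    (hlr : ∀ t ∈ Icc (0 : ℝ) 1, l t ≤ r t) (h1 : ∀ t ∈ Icc (0 : ℝ) 1, r t ≤ 1) :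
    ((∫ t in (0 : ℝ)..1, r t ^ 2) - (∫ t in (0 : ℝ)..1, r t) ^ 2) -
      ((∫ t in (0 : ℝ)..1, l t ^ 2) - (∫ t in (0 : ℝ)..1, l t) ^ 2) ≤
      1 / 3 * ((∫ t in (0 : ℝ)..1, r t) - ∫ t in (0 : ℝ)..1, l t) := by
  have h0r : ∀ t ∈ Icc (0 : ℝ) 1, 0 ≤ r t := fun t ht => (h0 t ht).trans (hlr t ht)
  have z0 : (0 : ℝ) ∈ Icc (0 : ℝ) 1 := by simp
  have z1 : (1 : ℝ) ∈ Icc (0 : ℝ) 1 := by simp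
  have A := var_concave_sub_var_chord_le hr hrc h0r h1
  have B := var_affine_sub_var_convex_le (p := r 0) (s := r 1 - r 0) hl hlc
    (fun t ht => by
      have := convexOn_apply hl z0 z1 (a := 1 - t) (b := t) (by linarith [ht.2]) ht.1 (by ring)
      simp only [mul_zero, zero_add, mul_one] at this
      have a1 := mul_le_mul_of_nonneg_left (hlr 0 z0) (sub_nonneg.2 ht.2)
      have a2 := mul_le_mul_of_nonneg_left (hlr 1 z1) ht.1
      nlinarith)
    (by rw [abs_le]; constructor <;> linarith [h0r 0 z0, h0r 1 z1, h1 0 z0, h1 1 z1])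
  linarith

lemma integral_const_sub_div {f : ℝ → ℝ} (hf : ContinuousOn f (Icc 0 1)) (c w : ℝ) :
    ∫ t in (0 : ℝ)..1, (c - f t) / w = (c - ∫ t in (0 : ℝ)..1, f t) / w := by
  rw [intervalIntegral.integral_div, intervalIntegral.integral_sub intervalIntegrable_const
    (intervalIntegrable_of_continuousOn hf)]
  simp

lemma integral_const_sub_div_sq {f : ℝ → ℝ} (hf : ContinuousOn f (Icc 0 1)) (c w : ℝ) :
    ∫ t in (0 : ℝ)..1, ((c - f t) / w) ^ 2 =
      (c ^ 2 - 2 * c * (∫ t in (0 : ℝ)..1, f t) + ∫ t in (0 : ℝ)..1, f t ^ 2) / w ^ 2 := by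
  have h1 := intervalIntegrable_of_continuousOn hf
  have h2 := intervalIntegrable_of_continuousOn (continuousOn_sq hf)
  have e : (fun t => ((c - f t) / w) ^ 2) = fun t => (c ^ 2 - 2 * c * f t + f t ^ 2) / w ^ 2 := by
    ext t; rw [div_pow]; ring
  rw [e, intervalIntegral.integral_div, intervalIntegral.integral_add
    (intervalIntegrable_const.sub (h1.const_mul _)) h2, intervalIntegral.integral_sub
    intervalIntegrable_const (h1.const_mul _), intervalIntegral.integral_const_mul]
  simp

/-- The substitution x ↦ (m + w - x)/w of the values interchanges the roles of l and r and brings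
them into [0, 1]; variances scale by w⁻² and means by w⁻¹. -/
lemma var_convex_sub_var_concave_le {l r : ℝ → ℝ} {m w : ℝ} (hw : 0 < w)
    (hr : ConcaveOn ℝ (Icc 0 1) r) (hl : ConvexOn ℝ (Icc 0 1) l)
    (hrc : ContinuousOn r (Icc 0 1)) (hlc : ContinuousOn l (Icc 0 1))
    (h0 : ∀ t ∈ Icc (0 : ℝ) 1, m ≤ l t) (hlr : ∀ t ∈ Icc (0 : ℝ) 1, l t ≤ r t)
    (h1 : ∀ t ∈ Icc (0 : ℝ) 1, r t ≤ m + w) :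
    ((∫ t in (0 : ℝ)..1, l t ^ 2) - (∫ t in (0 : ℝ)..1, l t) ^ 2) -
      ((∫ t in (0 : ℝ)..1, r t ^ 2) - (∫ t in (0 : ℝ)..1, r t) ^ 2) ≤
      w / 3 * ((∫ t in (0 : ℝ)..1, r t) - ∫ t in (0 : ℝ)..1, l t) := by
  have hc : ConcaveOn ℝ (Icc (0 : ℝ) 1) fun _ => m + w := concaveOn_const _ (convex_Icc 0 1)
  have hv : ConvexOn ℝ (Icc (0 : ℝ) 1) fun _ => m + w := convexOn_const _ (convex_Icc 0 1)
  have key := var_concave_sub_var_convex_le (r := fun t => (m + w - l t) / w)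
    (l := fun t => (m + w - r t) / w)
    (((hc.sub hl).smul (inv_nonneg.2 hw.le)).congr fun t _ => by simp [div_eq_inv_mul])
    (((hv.sub hr).smul (inv_nonneg.2 hw.le)).congr fun t _ => by simp [div_eq_inv_mul])
    ((continuousOn_const.sub hlc).div_const _) ((continuousOn_const.sub hrc).div_const _)
    (fun t ht => div_nonneg (by linarith [h1 t ht]) hw.le)
    (fun t ht => div_le_div_of_nonneg_right (by linarith [hlr t ht]) hw.le)
    (fun t ht => by rw [div_le_one hw]; linarith [h0 t ht])
  rw [integral_const_sub_div hlc, integral_const_sub_div hrc, integral_const_sub_div_sq hlc,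
    integral_const_sub_div_sq hrc] at key
  have k2 := mul_le_mul_of_nonneg_left key (sq_nonneg w)
  field_simp at k2
  field_simp
  linarith

/-! ### Averages over parallel chords against the area centroid. -/

/-- Comparison of the midpoint average over vertical chords with the first moment of the region
between a convex and a concave graph over the unit interval, in a direction in which the region
has width at most `w`. -/
lemma chord_mean_le_of_pos {f g : ℝ → ℝ} {α β m w : ℝ} (hβ : 0 < β) (hw : 0 < w)
    (hf : ConcaveOn ℝ (Icc 0 1) f) (hg : ConvexOn ℝ (Icc 0 1) g)
    (hfc : ContinuousOn f (Icc 0 1)) (hgc : ContinuousOn g (Icc 0 1))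
    (hgf : ∀ t ∈ Icc (0 : ℝ) 1, g t ≤ f t) (h0 : ∀ t ∈ Icc (0 : ℝ) 1, m ≤ α * t + β * g t)
    (h1 : ∀ t ∈ Icc (0 : ℝ) 1, α * t + β * f t ≤ m + w) :
    (∫ t in (0 : ℝ)..1, (2 * α * t + β * (f t + g t))) * ∫ t in (0 : ℝ)..1, (f t - g t) ≤
      2 * (∫ t in (0 : ℝ)..1, (α * t * (f t - g t) + β * (f t ^ 2 - g t ^ 2) / 2)) +
      w / 3 * ∫ t in (0 : ℝ)..1, (f t - g t) := by
  have hlin : Continuous fun t : ℝ => α * t := by fun_prop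
  have hlcc : ConcaveOn ℝ (Icc (0 : ℝ) 1) fun t => α * t :=
    ⟨convex_Icc 0 1, fun x _ y _ a b _ _ _ => by
      simp only [smul_eq_mul]; apply le_of_eq; ring⟩
  have hlcv : ConvexOn ℝ (Icc (0 : ℝ) 1) fun t => α * t :=
    ⟨convex_Icc 0 1, fun x _ y _ a b _ _ _ => by
      simp only [smul_eq_mul]; apply le_of_eq; ring⟩
  have hrc : ContinuousOn (fun t => α * t + β * f t) (Icc 0 1) :=
    hlin.continuousOn.add (continuousOn_const.mul hfc)
  have hlc : ContinuousOn (fun t => α * t + β * g t) (Icc 0 1) :=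
    hlin.continuousOn.add (continuousOn_const.mul hgc)
  -- Let r and l be the values of the linear form at the upper and lower ends of a chord, R and L
  -- their integrals. Then β · area = R - L and 2β · moment = ∫r² - ∫l², so the claim multiplied by
  -- β is the variance inequality.
  have key := var_convex_sub_var_concave_le (m := m) hw (r := fun t => α * t + β * f t)
    (l := fun t => α * t + β * g t) (hlcc.add (hf.smul hβ.le)) (hlcv.add (hg.smul hβ.le))
    hrc hlc h0
    (fun t ht => by linarith [mul_le_mul_of_nonneg_left (hgf t ht) hβ.le]) h1
  have ir := intervalIntegrable_of_continuousOn hrc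
  have il := intervalIntegrable_of_continuousOn hlc
  have ir2 := intervalIntegrable_of_continuousOn (continuousOn_sq hrc)
  have il2 := intervalIntegrable_of_continuousOn (continuousOn_sq hlc)
  have e1 : (∫ t in (0 : ℝ)..1, (α * t + β * f t)) - (∫ t in (0 : ℝ)..1, (α * t + β * g t)) =
      β * ∫ t in (0 : ℝ)..1, (f t - g t) := by
    rw [← intervalIntegral.integral_sub ir il, ← intervalIntegral.integral_const_mul]
    congr 1; ext t; ring
  have e2 : (∫ t in (0 : ℝ)..1, (α * t + β * f t)) + (∫ t in (0 : ℝ)..1, (α * t + β * g t)) =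
      ∫ t in (0 : ℝ)..1, (2 * α * t + β * (f t + g t)) := by
    rw [← intervalIntegral.integral_add ir il]
    congr 1; ext t; ring
  have e3 : (∫ t in (0 : ℝ)..1, (α * t + β * f t) ^ 2) -
      (∫ t in (0 : ℝ)..1, (α * t + β * g t) ^ 2) =
      2 * β * ∫ t in (0 : ℝ)..1, (α * t * (f t - g t) + β * (f t ^ 2 - g t ^ 2) / 2) := by
    rw [← intervalIntegral.integral_sub ir2 il2, ← intervalIntegral.integral_const_mul]
    congr 1; ext t; ring
  rw [← e2]
  set R := ∫ t in (0 : ℝ)..1, (α * t + β * f t)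
  set L := ∫ t in (0 : ℝ)..1, (α * t + β * g t)
  set A := ∫ t in (0 : ℝ)..1, (f t - g t)
  refine le_of_mul_le_mul_left ?_ hβ
  linear_combination key + e3 + (w / 3 - (R + L)) * e1

lemma chord_mean_le {f g : ℝ → ℝ} {α β m w : ℝ} (hw : 0 < w)
    (hf : ConcaveOn ℝ (Icc 0 1) f) (hg : ConvexOn ℝ (Icc 0 1) g)
    (hfc : ContinuousOn f (Icc 0 1)) (hgc : ContinuousOn g (Icc 0 1))
    (hgf : ∀ t ∈ Icc (0 : ℝ) 1, g t ≤ f t)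
    (hmg : ∀ t ∈ Icc (0 : ℝ) 1, α * t + β * g t ∈ Icc m (m + w))
    (hmf : ∀ t ∈ Icc (0 : ℝ) 1, α * t + β * f t ∈ Icc m (m + w)) :
    (∫ t in (0 : ℝ)..1, (2 * α * t + β * (f t + g t))) * ∫ t in (0 : ℝ)..1, (f t - g t) ≤
      2 * (∫ t in (0 : ℝ)..1, (α * t * (f t - g t) + β * (f t ^ 2 - g t ^ 2) / 2)) +
      w / 3 * ∫ t in (0 : ℝ)..1, (f t - g t) := by
  rcases lt_trichotomy β 0 with hβ | hβ | hβ
  -- Reflection in the horizontal axis changes the sign of β and swaps the two graphs.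
  · have := chord_mean_le_of_pos (f := -g) (g := -f) (neg_pos.2 hβ) hw hg.neg hf.neg
      hgc.neg hfc.neg (fun t ht => neg_le_neg (hgf t ht))
      (fun t ht => by simpa using (hmf t ht).1) (fun t ht => by simpa using (hmg t ht).2)
    have a1 : ∀ t, 2 * α * t + -β * (-g t + -f t) = 2 * α * t + β * (f t + g t) :=
      fun t => by ring
    have a2 : ∀ t, -g t - -f t = f t - g t := fun t => by ring
    have a3 : ∀ t, α * t * (f t - g t) + -β * ((-g t) ^ 2 - (-f t) ^ 2) / 2 =
      α * t * (f t - g t) + β * (f t ^ 2 - g t ^ 2) / 2 := fun t => by ring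
    simp only [Pi.neg_apply, a1, a2, a3] at this
    exact this
  -- The form is constant on each chord, so the variance argument is void. The claim is then that
  -- the centroid of the chord length f - g is within 1/6 of 1/2, multiplied by |α| ≤ w.
  · subst hβ
    have hδ : ConcaveOn ℝ (Icc 0 1) fun t => f t - g t := hf.sub hg
    have hδc : ContinuousOn (fun t => f t - g t) (Icc 0 1) := hfc.sub hgc
    have hδ0 : ∀ t ∈ Icc (0 : ℝ) 1, 0 ≤ f t - g t := fun t ht => sub_nonneg.2 (hgf t ht)
    have c1 := integral_mul_le_of_concaveOn hδ hδc hδ0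
    have c2 := le_integral_mul_of_concaveOn hδ hδc hδ0
    have c3 := intervalIntegral.integral_nonneg (μ := volume) zero_le_one hδ0
    have e1 : ∫ t in (0 : ℝ)..1, (2 * α * t + 0 * (f t + g t)) = α := by
      have := integral_affine 0 (2 * α)
      simp only [zero_add] at this
      simp only [zero_mul, add_zero, this]; ring
    have e2 : ∫ t in (0 : ℝ)..1, (α * t * (f t - g t) + 0 * (f t ^ 2 - g t ^ 2) / 2) =
        α * ∫ t in (0 : ℝ)..1, t * (f t - g t) := by
      rw [← intervalIntegral.integral_const_mul]
      congr 1; ext t; ring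
    rw [e1, e2]
    have m0 := hmg 0 (by simp)
    have m1 := hmg 1 (by simp)
    simp only [mul_zero, zero_mul, add_zero, mul_one] at m0 m1
    set A := ∫ t in (0 : ℝ)..1, (f t - g t)
    set T := ∫ t in (0 : ℝ)..1, t * (f t - g t)
    have h1 : |A / 2 - T| ≤ A / 6 := by rw [abs_le]; constructor <;> linarith
    have h2 : |α| ≤ w := by rw [abs_le]; constructor <;> linarith [m0.1, m0.2, m1.1, m1.2]
    have h3 : α * (A / 2 - T) ≤ w * (A / 6) := by
      calc _ ≤ |α * (A / 2 - T)| := le_abs_self _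
        _ = |α| * |A / 2 - T| := abs_mul _ _
        _ ≤ _ := mul_le_mul h2 h1 (abs_nonneg _) hw.le
    linarith
  · exact chord_mean_le_of_pos hβ hw hf hg hfc hgc hgf (fun t ht => (hmg t ht).1)
      (fun t ht => (hmf t ht).2)

lemma chord_mean_le_interval {f g : ℝ → ℝ} {a b α β m w : ℝ} (hab : a < b) (hw : 0 < w)
    (hf : ConcaveOn ℝ (Icc a b) f) (hg : ConvexOn ℝ (Icc a b) g)
    (hfc : ContinuousOn f (Icc a b)) (hgc : ContinuousOn g (Icc a b))
    (hgf : ∀ t ∈ Icc a b, g t ≤ f t)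
    (hmg : ∀ t ∈ Icc a b, α * t + β * g t ∈ Icc m (m + w))
    (hmf : ∀ t ∈ Icc a b, α * t + β * f t ∈ Icc m (m + w)) :
    (∫ t in a..b, (2 * α * t + β * (f t + g t))) * ∫ t in a..b, (f t - g t) ≤
      (b - a) * (2 * (∫ t in a..b, (α * t * (f t - g t) + β * (f t ^ 2 - g t ^ 2) / 2)) +
      w / 3 * ∫ t in a..b, (f t - g t)) := by
  have ha : a ∈ Icc a b := left_mem_Icc.2 hab.le
  have hb : b ∈ Icc a b := right_mem_Icc.2 hab.le
  have hm := mapsTo_affine_Icc ha hb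
  have key := chord_mean_le (f := fun s => f (a + (b - a) * s)) (g := fun s => g (a + (b - a) * s))
    (α := α * (b - a)) (β := β) (m := m - α * a) hw (concaveOn_comp_affine hf ha hb)
    (convexOn_comp_affine hg ha hb) (continuousOn_comp_affine hfc ha hb)
    (continuousOn_comp_affine hgc ha hb) (fun t ht => hgf _ (hm ht))
    (fun t ht => by
      have := hmg _ (hm ht)
      constructor <;> linarith [this.1, this.2])
    (fun t ht => by
      have := hmf _ (hm ht)
      constructor <;> linarith [this.1, this.2])
  have hF : ContinuousOn (fun s => f (a + (b - a) * s)) (Icc 0 1) :=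
    continuousOn_comp_affine hfc ha hb
  have hG : ContinuousOn (fun s => g (a + (b - a) * s)) (Icc 0 1) :=
    continuousOn_comp_affine hgc ha hb
  rw [integral_eq_comp_affine _ a b, integral_eq_comp_affine (fun t => f t - g t) a b,
    integral_eq_comp_affine (fun t => α * t * (f t - g t) + β * (f t ^ 2 - g t ^ 2) / 2) a b]
  have e1 : ∫ s in (0 : ℝ)..1, (2 * α * (a + (b - a) * s) +
      β * (f (a + (b - a) * s) + g (a + (b - a) * s))) = 2 * α * a +
      ∫ s in (0 : ℝ)..1, (2 * (α * (b - a)) * s +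
        β * (f (a + (b - a) * s) + g (a + (b - a) * s))) := by
    have : 2 * α * a = ∫ s in (0 : ℝ)..1, 2 * α * a := by simp
    nth_rw 1 [this]
    rw [← intervalIntegral.integral_add intervalIntegrable_const
      (intervalIntegrable_of_continuousOn (by fun_prop))]
    congr 1; ext s; ring
  have e2 : ∫ s in (0 : ℝ)..1, (α * (a + (b - a) * s) * (f (a + (b - a) * s) - g (a + (b - a) * s))
      + β * (f (a + (b - a) * s) ^ 2 - g (a + (b - a) * s) ^ 2) / 2) =
      α * a * (∫ s in (0 : ℝ)..1, (f (a + (b - a) * s) - g (a + (b - a) * s))) +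
      ∫ s in (0 : ℝ)..1, (α * (b - a) * s * (f (a + (b - a) * s) - g (a + (b - a) * s))
      + β * (f (a + (b - a) * s) ^ 2 - g (a + (b - a) * s) ^ 2) / 2) := by
    rw [← intervalIntegral.integral_const_mul, ← intervalIntegral.integral_add
      (intervalIntegrable_of_continuousOn (by fun_prop))
      (intervalIntegrable_of_continuousOn (by fun_prop))]
    congr 1; ext s; ring
  rw [e1, e2]
  have := mul_le_mul_of_nonneg_left key (sq_nonneg (b - a))
  linarith

/-! ### Planar convex bodies as regions between two graphs. -/

open Filter Topology

/-- `K` is the region between the graph of a convex function `g` and that of a concave function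
`f` over the interval `[a, b]`. -/
structure IsGraphRegion (K : Set (ℝ × ℝ)) (a b : ℝ) (g f : ℝ → ℝ) : Prop where
  lt : a < b
  concave : ConcaveOn ℝ (Icc a b) f
  convex : ConvexOn ℝ (Icc a b) g
  cont_top : ContinuousOn f (Icc a b)
  cont_bot : ContinuousOn g (Icc a b)
  le : ∀ t ∈ Icc a b, g t ≤ f t
  lt_of_mem : ∀ t ∈ Ioo a b, g t < f t
  mem_iff : ∀ p, p ∈ K ↔ p.1 ∈ Icc a b ∧ p.2 ∈ Icc (g p.1) (f p.1)

/-- Upper semicontinuity is the closedness of the superlevel sets; lower semicontinuity, also at the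
endpoints, comes from concavity, as f lies above its chords to a and b. -/
lemma continuousOn_of_concaveOn_of_isClosed {f : ℝ → ℝ} {a b : ℝ}
    (hf : ConcaveOn ℝ (Icc a b) f) (hcl : ∀ c, IsClosed {t | t ∈ Icc a b ∧ c ≤ f t}) :
    ContinuousOn f (Icc a b) := by
  intro t₀ ht₀
  have ha : a ∈ Icc a b := ⟨le_rfl, ht₀.1.trans ht₀.2⟩
  have hb : b ∈ Icc a b := ⟨ht₀.1.trans ht₀.2, le_rfl⟩
  refine tendsto_order.2 ⟨fun c hc => ?_, fun c hc => ?_⟩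
  -- Slopes of the chords from t₀ to the two endpoints. If t₀ is an endpoint, the slope on that side
  -- is 0/0 = 0 and is harmless, since only t = t₀ occurs there.
  · set A := (f t₀ - f a) / (t₀ - a)
    set B := (f b - f t₀) / (b - t₀)
    have hψ : Continuous fun t => f t₀ + min ((t - t₀) * A) ((t - t₀) * B) := by fun_prop
    have h1 : ∀ᶠ t in 𝓝 t₀, c < f t₀ + min ((t - t₀) * A) ((t - t₀) * B) :=
      hψ.continuousAt.eventually (lt_mem_nhds (by simpa using hc))
    filter_upwards [mem_nhdsWithin_of_mem_nhds h1, self_mem_nhdsWithin] with t ht htI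
    refine ht.trans_le ?_
    rcases le_total t t₀ with h | h
    · refine (add_le_add_right (min_le_left _ _) _).trans ?_
      rcases ht₀.1.eq_or_lt with h2 | h2
      · rw [show t = t₀ from le_antisymm h (h2 ▸ htI.1)]; simp
      · have hd : 0 < t₀ - a := sub_pos.2 h2
        have := concaveOn_apply hf ha ht₀ (a := (t₀ - t) / (t₀ - a)) (b := (t - a) / (t₀ - a))
          (div_nonneg (sub_nonneg.2 h) hd.le) (div_nonneg (sub_nonneg.2 htI.1) hd.le)
          (by field_simp; ring)
        rw [show (t₀ - t) / (t₀ - a) * a + (t - a) / (t₀ - a) * t₀ = t by field_simp; ring] at this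
        refine le_trans (le_of_eq ?_) this
        simp only [A]; field_simp; ring
    · refine (add_le_add_right (min_le_right _ _) _).trans ?_
      rcases ht₀.2.eq_or_lt with h2 | h2
      · rw [show t = t₀ from le_antisymm (h2 ▸ htI.2) h]; simp
      · have hd : 0 < b - t₀ := sub_pos.2 h2
        have := concaveOn_apply hf hb ht₀ (a := (t - t₀) / (b - t₀)) (b := (b - t) / (b - t₀))
          (div_nonneg (sub_nonneg.2 h) hd.le) (div_nonneg (sub_nonneg.2 htI.2) hd.le)
          (by field_simp; ring)
        rw [show (t - t₀) / (b - t₀) * b + (b - t) / (b - t₀) * t₀ = t by field_simp; ring] at this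
        refine le_trans (le_of_eq ?_) this
        simp only [B]; field_simp; ring
  · have h1 : {t | t ∈ Icc a b ∧ c ≤ f t}ᶜ ∈ 𝓝 t₀ :=
      (hcl c).isOpen_compl.mem_nhds fun h => absurd h.2 (not_le.2 hc)
    filter_upwards [mem_nhdsWithin_of_mem_nhds h1, self_mem_nhdsWithin] with t ht htI
    by_contra hcon
    exact ht ⟨htI, not_lt.1 hcon⟩

/-- The first projection of K and each of its vertical fibres are compact intervals; f and g are the
tops and bottoms of the fibres. -/
lemma exists_isGraphRegion {K : Set (ℝ × ℝ)} (hK : IsCompact K) (hconv : Convex ℝ K)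
    (hint : (interior K).Nonempty) : ∃ a b g f, IsGraphRegion K a b g f := by
  have hne : K.Nonempty := hint.mono interior_subset
  have hconn : IsConnected (Prod.fst '' K) :=
    ⟨hne.image _, hconv.isPreconnected.image _ continuous_fst.continuousOn⟩
  have hIcc := eq_Icc_of_connected_compact hconn (hK.image continuous_fst)
  set a := sInf (Prod.fst '' K)
  set b := sSup (Prod.fst '' K)
  set S : ℝ → Set ℝ := fun t => {y | (t, y) ∈ K} with hS
  have hSc : ∀ t, IsCompact (S t) := fun t => by
    have : S t = Prod.snd '' (K ∩ Prod.fst ⁻¹' {t}) := by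
      ext y; simp [hS]
    rw [this]
    exact (hK.inter_right (isClosed_singleton.preimage continuous_fst)).image continuous_snd
  have hSne : ∀ t ∈ Icc a b, (S t).Nonempty := fun t ht => by
    rw [← hIcc] at ht
    obtain ⟨p, hp, rfl⟩ := ht
    exact ⟨p.2, hp⟩
  have hSI : ∀ t ∈ Icc a b, S t = Icc (sInf (S t)) (sSup (S t)) := fun t ht => by
    apply eq_Icc_of_connected_compact _ (hSc t)
    refine ⟨hSne t ht, Convex.isPreconnected ?_⟩
    intro x hx y hy p q hp hq hpq
    have := hconv hx hy hp hq hpq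
    simpa [hS, ← add_mul, hpq] using this
  set f : ℝ → ℝ := fun t => sSup (S t) with hf
  set g : ℝ → ℝ := fun t => sInf (S t) with hg
  have hmem : ∀ p, p ∈ K ↔ p.1 ∈ Icc a b ∧ p.2 ∈ Icc (g p.1) (f p.1) := fun p => by
    constructor
    · intro hp
      have h1 : p.1 ∈ Icc a b := hIcc ▸ ⟨p, hp, rfl⟩
      exact ⟨h1, by rw [← hSI _ h1]; exact hp⟩
    · rintro ⟨h1, h2⟩
      rw [← hSI _ h1] at h2
      exact h2
  have hle : ∀ t ∈ Icc a b, g t ≤ f t := fun t ht => by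
    rw [← nonempty_Icc, ← hSI t ht]; exact hSne t ht
  have hconc : ConcaveOn ℝ (Icc a b) f := by
    refine ⟨convex_Icc a b, fun x hx y hy p q hp hq hpq => ?_⟩
    have := hconv ((hmem (x, f x)).2 ⟨hx, hle x hx, le_rfl⟩)
      ((hmem (y, f y)).2 ⟨hy, hle y hy, le_rfl⟩) hp hq hpq
    exact ((hmem _).1 this).2.2
  have hcvx : ConvexOn ℝ (Icc a b) g := by
    refine ⟨convex_Icc a b, fun x hx y hy p q hp hq hpq => ?_⟩
    have := hconv ((hmem (x, g x)).2 ⟨hx, le_rfl, hle x hx⟩)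
      ((hmem (y, g y)).2 ⟨hy, le_rfl, hle y hy⟩) hp hq hpq
    exact ((hmem _).1 this).2.1
  have hcf : ContinuousOn f (Icc a b) := by
    refine continuousOn_of_concaveOn_of_isClosed hconc fun c => ?_
    have : {t | t ∈ Icc a b ∧ c ≤ f t} = Prod.fst '' (K ∩ Prod.snd ⁻¹' Ici c) := by
      ext t
      constructor
      · rintro ⟨h1, h2⟩
        exact ⟨(t, f t), ⟨(hmem _).2 ⟨h1, hle t h1, le_rfl⟩, h2⟩, rfl⟩
      · rintro ⟨p, ⟨h1, h2⟩, rfl⟩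
        exact ⟨((hmem _).1 h1).1, le_trans h2 ((hmem _).1 h1).2.2⟩
    rw [this]
    exact ((hK.inter_right (isClosed_Ici.preimage continuous_snd)).image continuous_fst).isClosed
  have hcg : ContinuousOn g (Icc a b) := by
    have : ContinuousOn (-g) (Icc a b) := by
      refine continuousOn_of_concaveOn_of_isClosed hcvx.neg fun c => ?_
      have : {t | t ∈ Icc a b ∧ c ≤ (-g) t} = Prod.fst '' (K ∩ Prod.snd ⁻¹' Iic (-c)) := by
        ext t
        constructor
        · rintro ⟨h1, h2⟩
          exact ⟨(t, g t), ⟨(hmem _).2 ⟨h1, le_rfl, hle t h1⟩, le_neg.1 h2⟩, rfl⟩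
        · rintro ⟨p, ⟨h1, h2⟩, rfl⟩
          exact ⟨((hmem _).1 h1).1, le_neg.1 (le_trans ((hmem _).1 h1).2.1 h2)⟩
      rw [this]
      exact ((hK.inter_right (isClosed_Iic.preimage continuous_snd)).image
        continuous_fst).isClosed
    simpa using this.neg
  obtain ⟨⟨x, y⟩, hxy⟩ := hint
  obtain ⟨ε, hε, hball⟩ := Metric.isOpen_iff.1 isOpen_interior _ hxy
  have hin : ∀ s z, |s - x| < ε → |z - y| < ε → (s, z) ∈ K := fun s z h1 h2 => by
    apply interior_subset (hball _)
    rw [Metric.mem_ball, Prod.dist_eq]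
    exact max_lt h1 h2
  have hx1 := ((hmem _).1 (hin (x - ε / 2) y (by rw [abs_lt]; constructor <;> linarith)
    (by simpa using hε))).1.1
  have hx2 := ((hmem _).1 (hin (x + ε / 2) y (by rw [abs_lt]; constructor <;> linarith)
    (by simpa using hε))).1.2
  have hy1 := ((hmem _).1 (hin x (y - ε / 2) (by simpa using hε)
    (by rw [abs_lt]; constructor <;> linarith))).2.1
  have hy2 := ((hmem _).1 (hin x (y + ε / 2) (by simpa using hε)
    (by rw [abs_lt]; constructor <;> linarith))).2.2
  dsimp only at hx1 hx2 hy1 hy2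
  have hxI : x ∈ Icc a b := ⟨by linarith, by linarith⟩
  refine ⟨a, b, g, f, by linarith, hconc, hcvx, hcf, hcg, hle, fun t ht => ?_, hmem⟩
  -- The height f - g is concave, nonnegative at a and b, and positive over an interior point x of
  -- K, hence positive on the open interval.
  have hδ : ConcaveOn ℝ (Icc a b) fun t => f t - g t := hconc.sub hcvx
  have hxpos : 0 < f x - g x := by linarith
  have aux : ∀ e ∈ Icc a b, ∀ p q : ℝ, 0 < p → 0 ≤ q → p + q = 1 → p * x + q * e = t →
      g t < f t := fun e he p q hp hq hpq hpe => by
    have h1 := concaveOn_apply hδ hxI he hp.le hq hpq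
    rw [hpe] at h1
    have h2 := mul_pos hp hxpos
    have h3 := mul_nonneg hq (sub_nonneg.2 (hle e he))
    linarith
  rcases le_total t x with h | h
  · have hd : 0 < x - a := by linarith [ht.1]
    exact aux a ⟨le_rfl, by linarith⟩ ((t - a) / (x - a)) ((x - t) / (x - a))
      (div_pos (by linarith [ht.1]) hd) (div_nonneg (by linarith) hd.le) (by field_simp; ring)
      (by field_simp; ring)
  · have hd : 0 < b - x := by linarith [ht.2]
    exact aux b ⟨by linarith, le_rfl⟩ ((b - t) / (b - x)) ((t - x) / (b - x))
      (div_pos (by linarith [ht.2]) hd) (div_nonneg (by linarith) hd.le) (by field_simp; ring)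
      (by field_simp; ring)

namespace IsGraphRegion

variable {K : Set (ℝ × ℝ)} {a b : ℝ} {g f : ℝ → ℝ}

lemma mem_top (h : IsGraphRegion K a b g f) {t : ℝ} (ht : t ∈ Icc a b) : (t, f t) ∈ K :=
  (h.mem_iff _).2 ⟨ht, h.le t ht, le_rfl⟩

lemma mem_bot (h : IsGraphRegion K a b g f) {t : ℝ} (ht : t ∈ Icc a b) : (t, g t) ∈ K :=
  (h.mem_iff _).2 ⟨ht, le_rfl, h.le t ht⟩

lemma mem_interior (h : IsGraphRegion K a b g f) {p : ℝ × ℝ} (hp : p.1 ∈ Ioo a b)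
    (h1 : g p.1 < p.2) (h2 : p.2 < f p.1) : p ∈ interior K := by
  have hs : IsOpen (Prod.fst ⁻¹' Ioo a b : Set (ℝ × ℝ)) := isOpen_Ioo.preimage continuous_fst
  have hm : MapsTo Prod.fst (Prod.fst ⁻¹' Ioo a b : Set (ℝ × ℝ)) (Icc a b) :=
    fun q hq => Ioo_subset_Icc_self hq
  have c1 : ContinuousOn (fun q : ℝ × ℝ => q.2 - g q.1) (Prod.fst ⁻¹' Ioo a b) :=
    continuous_snd.continuousOn.sub (h.cont_bot.comp continuous_fst.continuousOn hm)
  have c2 : ContinuousOn (fun q : ℝ × ℝ => f q.1 - q.2) (Prod.fst ⁻¹' Ioo a b) :=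
    (h.cont_top.comp continuous_fst.continuousOn hm).sub continuous_snd.continuousOn
  have o1 := c1.isOpen_inter_preimage hs isOpen_Ioi (t := Ioi 0)
  have o2 := c2.isOpen_inter_preimage hs isOpen_Ioi (t := Ioi 0)
  refine _root_.mem_interior.2 ⟨_, ?_, o1.inter o2, ⟨hp, sub_pos.2 h1⟩, hp, sub_pos.2 h2⟩
  rintro q ⟨⟨hq, hq1⟩, -, hq2⟩
  exact (h.mem_iff q).2 ⟨hm hq, (sub_pos.1 hq1).le, (sub_pos.1 hq2).le⟩

lemma isClosed (h : IsGraphRegion K a b g f) : IsClosed K := by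
  have hs : IsClosed (Prod.fst ⁻¹' Icc a b : Set (ℝ × ℝ)) := isClosed_Icc.preimage continuous_fst
  have hm : MapsTo Prod.fst (Prod.fst ⁻¹' Icc a b : Set (ℝ × ℝ)) (Icc a b) := fun q hq => hq
  have c1 := h.cont_bot.comp continuous_fst.continuousOn hm
  have c2 := h.cont_top.comp continuous_fst.continuousOn hm
  have : K = {q ∈ Prod.fst ⁻¹' Icc a b | (g ∘ Prod.fst) q ≤ q.2} ∩
      {q ∈ Prod.fst ⁻¹' Icc a b | q.2 ≤ (f ∘ Prod.fst) q} := by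
    ext q
    rw [h.mem_iff]
    constructor
    · rintro ⟨h1, h2, h3⟩; exact ⟨⟨h1, h2⟩, h1, h3⟩
    · rintro ⟨⟨h1, h2⟩, -, h3⟩; exact ⟨h1, h2, h3⟩
  rw [this]
  exact (hs.isClosed_le c1 continuous_snd.continuousOn).inter
    (hs.isClosed_le continuous_snd.continuousOn c2)

/-- Restricting to the open interval leaves out the possible vertical sides over a and b, which
belong to the frontier but not to the graphs. -/
lemma mem_frontier_iff (h : IsGraphRegion K a b g f) {p : ℝ × ℝ} (hp : p.1 ∈ Ioo a b) :
    p ∈ frontier K ↔ p.2 = g p.1 ∨ p.2 = f p.1 := by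
  have hpI := Ioo_subset_Icc_self hp
  rw [h.isClosed.frontier_eq]
  constructor
  · rintro ⟨h1, h2⟩
    by_contra! hcon
    have h3 := ((h.mem_iff p).1 h1).2
    exact h2 (h.mem_interior hp (lt_of_le_of_ne h3.1 hcon.1.symm) (lt_of_le_of_ne h3.2 hcon.2))
  · intro h1
    have hpK : p ∈ K := by
      refine (h.mem_iff p).2 ⟨hpI, ?_⟩
      rcases h1 with h1 | h1 <;> rw [h1]
      exacts [⟨le_rfl, h.le _ hpI⟩, ⟨h.le _ hpI, le_rfl⟩]
    refine ⟨hpK, fun hcon => ?_⟩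
    obtain ⟨ε, hε, hball⟩ := Metric.isOpen_iff.1 isOpen_interior _ hcon
    have hin : ∀ z, |z - p.2| < ε → z ∈ Icc (g p.1) (f p.1) := fun z hz => by
      refine ((h.mem_iff (p.1, z)).1 (interior_subset (hball ?_))).2
      rw [Metric.mem_ball, Prod.dist_eq]
      exact max_lt (by simpa using hε) hz
    have e1 := (hin (p.2 - ε / 2) (by rw [abs_lt]; constructor <;> linarith)).1
    have e2 := (hin (p.2 + ε / 2) (by rw [abs_lt]; constructor <;> linarith)).2
    rcases h1 with h1 | h1 <;> linarith

lemma image_fst (h : IsGraphRegion K a b g f) : Prod.fst '' K = Icc a b := by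
  ext t
  constructor
  · rintro ⟨p, hp, rfl⟩; exact ((h.mem_iff p).1 hp).1
  · intro ht; exact ⟨_, h.mem_top ht, rfl⟩

lemma setIntegral (h : IsGraphRegion K a b g f) (hK : IsCompact K) {φ : ℝ × ℝ → ℝ}
    (hφ : Continuous φ) :
    ∫ p in K, φ p = ∫ t in a..b, ∫ y in (g t)..(f t), φ (t, y) := by
  have hm : MeasurableSet K := h.isClosed.measurableSet
  rw [← integral_indicator hm, Measure.volume_eq_prod, integral_prod]
  · rw [intervalIntegral.integral_of_le h.lt.le, ← integral_Icc_eq_integral_Ioc,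
      ← integral_indicator measurableSet_Icc]
    congr 1
    ext t
    by_cases ht : t ∈ Icc a b
    · rw [indicator_of_mem ht, intervalIntegral.integral_of_le (h.le t ht),
        ← integral_Icc_eq_integral_Ioc, ← integral_indicator measurableSet_Icc]
      congr 1
      ext y
      by_cases hy : y ∈ Icc (g t) (f t)
      · rw [indicator_of_mem hy, indicator_of_mem ((h.mem_iff _).2 ⟨ht, hy⟩)]
      · rw [indicator_of_notMem hy, indicator_of_notMem fun hc => hy ((h.mem_iff _).1 hc).2]
    · rw [indicator_of_notMem ht]
      simp only [indicator_of_notMem fun hc => ht ((h.mem_iff (t, _)).1 hc).1, integral_zero]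
  · rw [← Measure.volume_eq_prod, integrable_indicator_iff hm]
    exact hφ.continuousOn.integrableOn_compact hK

end IsGraphRegion

/-! ### Orthonormal frames of the plane. -/

abbrev Plane := EuclideanSpace ℝ (Fin 2)

/-- Rotation by a right angle. -/
noncomputable def rot (u : Plane) : Plane := !₂[-u 1, u 0]

@[simp] lemma rot_zero (u : Plane) : rot u 0 = -u 1 := rfl
@[simp] lemma rot_one (u : Plane) : rot u 1 = u 0 := rfl

lemma inner_eq (x y : Plane) : inner ℝ x y = x 0 * y 0 + x 1 * y 1 := by
  simp [PiLp.inner_apply, Fin.sum_univ_two]; ring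

lemma norm_eq_one_iff (u : Plane) : ‖u‖ = 1 ↔ u 0 ^ 2 + u 1 ^ 2 = 1 := by
  rw [EuclideanSpace.norm_eq, Real.sqrt_eq_one, Fin.sum_univ_two]
  simp

lemma norm_rot (u : Plane) : ‖rot u‖ = ‖u‖ := by
  simp only [EuclideanSpace.norm_eq, Fin.sum_univ_two, rot_zero, rot_one, norm_neg]
  rw [add_comm]

lemma inner_rot_self (u : Plane) : inner ℝ u (rot u) = 0 := by
  rw [inner_eq, rot_zero, rot_one]; ring

/-- Coordinates with respect to the orthogonal frame `(u, rot u)`. -/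
noncomputable def frameMap (u : Plane) (p : ℝ × ℝ) : Plane := p.1 • u + p.2 • rot u

lemma inner_frameMap (e u : Plane) (p : ℝ × ℝ) :
    inner ℝ e (frameMap u p) = p.1 * inner ℝ e u + p.2 * inner ℝ e (rot u) := by
  rw [frameMap, inner_add_right, inner_smul_right, inner_smul_right]

lemma inner_self_frameMap {u : Plane} (hu : ‖u‖ = 1) (p : ℝ × ℝ) :
    inner ℝ u (frameMap u p) = p.1 := by
  rw [inner_frameMap, inner_rot_self, real_inner_self_eq_norm_sq, hu]; ring

lemma inner_rot_frameMap {u : Plane} (hu : ‖u‖ = 1) (p : ℝ × ℝ) :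
    inner ℝ (rot u) (frameMap u p) = p.2 := by
  rw [inner_frameMap, real_inner_comm, inner_rot_self, real_inner_self_eq_norm_sq, norm_rot, hu]
  ring

lemma inner_expand {u : Plane} (hu : ‖u‖ = 1) (x y : Plane) :
    inner ℝ x y = inner ℝ x u * inner ℝ u y + inner ℝ x (rot u) * inner ℝ (rot u) y := by
  rw [norm_eq_one_iff] at hu
  simp only [inner_eq, rot_zero, rot_one]
  linear_combination (-(x 0 * y 0 + x 1 * y 1)) * hu

lemma frameMap_inner {u : Plane} (hu : ‖u‖ = 1) (x : Plane) :
    frameMap u (inner ℝ u x, inner ℝ (rot u) x) = x := by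
  refine ext_inner_left ℝ fun e => ?_
  rw [inner_frameMap, inner_expand hu e x]; ring

lemma continuous_frameMap (u : Plane) : Continuous (frameMap u) := by
  unfold frameMap; fun_prop

/-- The frame coordinates as a homeomorphism. -/
noncomputable def frameHomeomorph {u : Plane} (hu : ‖u‖ = 1) : ℝ × ℝ ≃ₜ Plane where
  toFun := frameMap u
  invFun x := (inner ℝ u x, inner ℝ (rot u) x)
  left_inv p := by simp [inner_self_frameMap hu, inner_rot_frameMap hu]
  right_inv x := frameMap_inner hu x
  continuous_toFun := continuous_frameMap u
  continuous_invFun := by fun_prop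

lemma measurePreserving_frameMap {u : Plane} (hu : ‖u‖ = 1) :
    MeasurePreserving (frameMap u) := by
  have hon : Orthonormal ℝ ![u, rot u] := by
    rw [orthonormal_iff_ite]
    intro i j
    fin_cases i <;> fin_cases j <;>
      simp [inner_rot_self, hu, norm_rot, real_inner_comm]
  have hspan : ⊤ ≤ Submodule.span ℝ (Set.range ![u, rot u]) := by
    intro x _
    rw [← frameMap_inner hu x, frameMap]
    refine add_mem (Submodule.smul_mem _ _ (Submodule.subset_span ⟨0, rfl⟩))
      (Submodule.smul_mem _ _ (Submodule.subset_span ⟨1, rfl⟩))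
  let b := OrthonormalBasis.mk hon hspan
  have h1 := b.measurePreserving_repr_symm
  have h2 := PiLp.volume_preserving_toLp (Fin 2)
  have h3 := (volume_preserving_finTwoArrow ℝ).symm
  have e : frameMap u = (b.repr.symm ∘ WithLp.toLp 2) ∘ MeasurableEquiv.finTwoArrow.symm := by
    ext1 p
    rw [Function.comp_apply, Function.comp_apply, ← OrthonormalBasis.sum_repr_symm]
    simp [frameMap, b, Fin.sum_univ_two]
  rw [e]
  exact (h1.comp h2).comp h3

/-! ### Chord measures. -/

/-- A finite measure carried by the boundary of `Ω` which counts, with respect to Lebesgue measure,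
the boundary points on the lines orthogonal to `u`. -/
structure IsChordMeasure (Ω : Set Plane) (u : Plane) (ν : Measure Plane) : Prop where
  finite : IsFiniteMeasure ν
  compl : ν (frontier Ω)ᶜ = 0
  le_two_mul : ∀ B ⊆ frontier Ω, MeasurableSet B → ν B ≤ 2 * volume ((fun x => inner ℝ u x) '' B)
  image_le : ∀ B ⊆ frontier Ω, MeasurableSet B → volume ((fun x => inner ℝ u x) '' B) ≤ ν B
  le_of_injOn : ∀ B ⊆ frontier Ω, MeasurableSet B → InjOn (fun x => inner ℝ u x) B →
    ν B ≤ volume ((fun x => inner ℝ u x) '' B)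
  integral_comp : ∃ a b, a < b ∧ (fun x => inner ℝ u x) '' Ω = Icc a b ∧
    ∀ φ : ℝ → ℝ, Continuous φ → ∫ x, φ (inner ℝ u x) ∂ν = 2 * ∫ t in a..b, φ t
  mean_le : ∀ (e : Plane) (m w : ℝ), 0 < w → (∀ x ∈ Ω, inner ℝ e x ∈ Icc m (m + w)) →
    ∫ x, inner ℝ e x ∂ν ≤ (inner ℝ e (bodyCentroid Ω) + w / 6) * ν.real univ

/-- The image of Lebesgue measure on `(a, b)` under the two boundary graphs. -/
noncomputable def chordMeasure (u : Plane) (a b : ℝ) (g f : ℝ → ℝ) : Measure Plane :=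
  (volume.restrict (Ioo a b)).map (fun t => frameMap u (t, f t)) +
    (volume.restrict (Ioo a b)).map fun t => frameMap u (t, g t)

lemma aemeasurable_graph (u : Plane) {a b : ℝ} {f : ℝ → ℝ} (hf : ContinuousOn f (Icc a b)) :
    AEMeasurable (fun t => frameMap u (t, f t)) (volume.restrict (Ioo a b)) := by
  have : ContinuousOn (fun t => frameMap u (t, f t)) (Icc a b) :=
    (continuous_frameMap u).comp_continuousOn (continuousOn_id.prodMk hf)
  exact (this.mono Ioo_subset_Icc_self).aemeasurable measurableSet_Ioo

section

variable {Ω : Set Plane} {u : Plane} {a b : ℝ} {g f : ℝ → ℝ}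

lemma chordMeasure_apply (h : IsGraphRegion (frameMap u ⁻¹' Ω) a b g f) {B : Set Plane}
    (hB : MeasurableSet B) : chordMeasure u a b g f B =
      volume.restrict (Ioo a b) ((fun t => frameMap u (t, f t)) ⁻¹' B) +
      volume.restrict (Ioo a b) ((fun t => frameMap u (t, g t)) ⁻¹' B) := by
  rw [chordMeasure, Measure.add_apply, Measure.map_apply_of_aemeasurable
    (aemeasurable_graph u h.cont_top) hB, Measure.map_apply_of_aemeasurable
    (aemeasurable_graph u h.cont_bot) hB]

lemma integral_chordMeasure (h : IsGraphRegion (frameMap u ⁻¹' Ω) a b g f) {φ : Plane → ℝ}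
    (hφ : Continuous φ) : ∫ x, φ x ∂(chordMeasure u a b g f) =
      ∫ t in a..b, (φ (frameMap u (t, f t)) + φ (frameMap u (t, g t))) := by
  have hc : ∀ k : ℝ → ℝ, ContinuousOn k (Icc a b) →
      ContinuousOn (fun t => φ (frameMap u (t, k t))) (Icc a b) := fun k hk =>
    (hφ.comp (continuous_frameMap u)).comp_continuousOn (continuousOn_id.prodMk hk)
  have hi : ∀ k : ℝ → ℝ, ContinuousOn k (Icc a b) →
      Integrable (fun t => φ (frameMap u (t, k t))) (volume.restrict (Ioo a b)) := fun k hk =>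
    ((hc k hk).integrableOn_compact isCompact_Icc).mono_set Ioo_subset_Icc_self
  have him : ∀ k : ℝ → ℝ, ContinuousOn k (Icc a b) →
      Integrable φ ((volume.restrict (Ioo a b)).map fun t => frameMap u (t, k t)) := fun k hk =>
    (integrable_map_measure hφ.aestronglyMeasurable (aemeasurable_graph u hk)).2 (hi k hk)
  rw [chordMeasure, integral_add_measure (him f h.cont_top) (him g h.cont_bot),
    integral_map (aemeasurable_graph u h.cont_top) hφ.aestronglyMeasurable,
    integral_map (aemeasurable_graph u h.cont_bot) hφ.aestronglyMeasurable,
    ← integral_add (hi f h.cont_top) (hi g h.cont_bot),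
    intervalIntegral.integral_of_le h.lt.le, integral_Ioc_eq_integral_Ioo]

lemma mem_frontier_frameMap_iff (hu : ‖u‖ = 1) (h : IsGraphRegion (frameMap u ⁻¹' Ω) a b g f)
    {p : ℝ × ℝ} (hp : p.1 ∈ Ioo a b) :
    frameMap u p ∈ frontier Ω ↔ p.2 = g p.1 ∨ p.2 = f p.1 := by
  have := (frameHomeomorph hu).preimage_frontier Ω
  rw [← h.mem_frontier_iff hp]
  exact Set.ext_iff.1 this p

lemma image_inner_eq (hu : ‖u‖ = 1) (h : IsGraphRegion (frameMap u ⁻¹' Ω) a b g f) :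
    (fun x => inner ℝ u x) '' Ω = Icc a b := by
  rw [← h.image_fst]
  ext t
  constructor
  · rintro ⟨x, hx, rfl⟩
    exact ⟨(inner ℝ u x, inner ℝ (rot u) x), by rwa [mem_preimage, frameMap_inner hu], rfl⟩
  · rintro ⟨p, hp, rfl⟩
    exact ⟨_, hp, inner_self_frameMap hu p⟩

/-- Boundary points over the open interval lie on one of the two graphs; those over a and b project
to a null set. -/
lemma volume_image_eq (hu : ‖u‖ = 1) (hΩ : IsClosed Ω)
    (h : IsGraphRegion (frameMap u ⁻¹' Ω) a b g f) {B : Set Plane} (hB : B ⊆ frontier Ω) :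
    volume ((fun x => inner ℝ u x) '' B) = volume.restrict (Ioo a b)
      ((fun t => frameMap u (t, f t)) ⁻¹' B ∪ (fun t => frameMap u (t, g t)) ⁻¹' B) := by
  have hsub : (fun x => inner ℝ u x) '' B ⊆ Icc a b := by
    rw [← image_inner_eq hu h]
    exact image_mono (hB.trans hΩ.frontier_subset)
  have e : volume.restrict (Icc a b) = volume.restrict (Ioo a b) :=
    Measure.restrict_congr_set Ioo_ae_eq_Icc.symm
  have h1 : volume ((fun x => inner ℝ u x) '' B) =
      volume.restrict (Ioo a b) ((fun x => inner ℝ u x) '' B) := by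
    rw [← e, Measure.restrict_apply' measurableSet_Icc, inter_eq_left.2 hsub]
  rw [h1, Measure.restrict_apply' measurableSet_Ioo, Measure.restrict_apply' measurableSet_Ioo]
  congr 1
  ext t
  constructor
  · rintro ⟨⟨x, hx, rfl⟩, ht⟩
    refine ⟨?_, ht⟩
    have hx' := hB hx
    rw [← frameMap_inner hu x] at hx hx'
    rcases (mem_frontier_frameMap_iff hu h ht).1 hx' with h2 | h2
    · right; dsimp only at h2; rw [h2] at hx; exact hx
    · left; dsimp only at h2; rw [h2] at hx; exact hx
  · rintro ⟨ht | ht, htI⟩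
    · exact ⟨⟨_, ht, inner_self_frameMap hu _⟩, htI⟩
    · exact ⟨⟨_, ht, inner_self_frameMap hu _⟩, htI⟩

lemma setIntegral_body (hu : ‖u‖ = 1) (hΩ : IsCompact Ω)
    (h : IsGraphRegion (frameMap u ⁻¹' Ω) a b g f) {φ : Plane → ℝ} (hφ : Continuous φ) :
    ∫ x in Ω, φ x = ∫ t in a..b, ∫ y in (g t)..(f t), φ (frameMap u (t, y)) := by
  have hemb : MeasurableEmbedding (frameMap u) := (frameHomeomorph hu).measurableEmbedding
  have hK : IsCompact (frameMap u ⁻¹' Ω) := (frameHomeomorph hu).isCompact_preimage.2 hΩ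
  rw [← (measurePreserving_frameMap hu).setIntegral_preimage_emb hemb]
  exact h.setIntegral hK (hφ.comp (continuous_frameMap u))

lemma volume_body (hu : ‖u‖ = 1) (hΩ : IsCompact Ω)
    (h : IsGraphRegion (frameMap u ⁻¹' Ω) a b g f) :
    volume.real Ω = ∫ t in a..b, (f t - g t) := by
  have := setIntegral_body hu hΩ h (φ := fun _ => 1) continuous_const
  simpa using this

lemma volume_body_pos (hu : ‖u‖ = 1) (hΩ : IsCompact Ω)
    (h : IsGraphRegion (frameMap u ⁻¹' Ω) a b g f) : 0 < volume.real Ω := by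
  rw [volume_body hu hΩ h]
  refine intervalIntegral.intervalIntegral_pos_of_pos_on
    (ContinuousOn.intervalIntegrable ?_) (fun t ht => sub_pos.2 (h.lt_of_mem t ht)) h.lt
  rw [uIcc_of_le h.lt.le]
  exact h.cont_top.sub h.cont_bot

lemma inner_bodyCentroid (hΩ : IsCompact Ω) (e : Plane) :
    inner ℝ e (bodyCentroid Ω) = (volume.real Ω)⁻¹ * ∫ x in Ω, inner ℝ e x := by
  have hi : IntegrableOn (fun x : Plane => x) Ω := continuousOn_id.integrableOn_compact hΩ
  rw [bodyCentroid, inner_smul_right, ← integral_inner hi]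

lemma inner_bodyCentroid_mul (hu : ‖u‖ = 1) (hΩ : IsCompact Ω)
    (h : IsGraphRegion (frameMap u ⁻¹' Ω) a b g f) (e : Plane) :
    inner ℝ e (bodyCentroid Ω) * volume.real Ω = ∫ t in a..b, (inner ℝ e u * t * (f t - g t) +
      inner ℝ e (rot u) * (f t ^ 2 - g t ^ 2) / 2) := by
  have hpos := volume_body_pos hu hΩ h
  rw [inner_bodyCentroid hΩ, mul_comm, mul_inv_cancel_left₀ hpos.ne',
    setIntegral_body hu hΩ h (by fun_prop)]
  congr 1
  ext t
  simp only [inner_frameMap]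
  rw [intervalIntegral.integral_add (by simp)
    (Continuous.intervalIntegrable (by fun_prop) _ _), intervalIntegral.integral_mul_const,
    intervalIntegral.integral_mul_const, integral_id]
  simp; ring

lemma chordMeasure_univ (h : IsGraphRegion (frameMap u ⁻¹' Ω) a b g f) :
    chordMeasure u a b g f univ = 2 * ENNReal.ofReal (b - a) := by
  rw [chordMeasure_apply h MeasurableSet.univ]
  simp [two_mul]

lemma isChordMeasure_chordMeasure (hu : ‖u‖ = 1) (hΩ : IsCompact Ω)
    (h : IsGraphRegion (frameMap u ⁻¹' Ω) a b g f) :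
    IsChordMeasure Ω u (chordMeasure u a b g f) where
  finite := ⟨by rw [chordMeasure_univ h]; exact ENNReal.mul_lt_top (by simp) (by simp)⟩
  compl := by
    rw [chordMeasure_apply h isClosed_frontier.measurableSet.compl,
      Measure.restrict_apply' measurableSet_Ioo, Measure.restrict_apply' measurableSet_Ioo]
    have e1 : (fun t => frameMap u (t, f t)) ⁻¹' (frontier Ω)ᶜ ∩ Ioo a b = ∅ := by
      ext t
      simp only [mem_inter_iff, mem_preimage, mem_compl_iff, mem_empty_iff_false, iff_false, not_and]
      exact fun h1 ht => h1 ((mem_frontier_frameMap_iff hu h (p := (t, f t)) ht).2 (Or.inr rfl))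
    have e2 : (fun t => frameMap u (t, g t)) ⁻¹' (frontier Ω)ᶜ ∩ Ioo a b = ∅ := by
      ext t
      simp only [mem_inter_iff, mem_preimage, mem_compl_iff, mem_empty_iff_false, iff_false, not_and]
      exact fun h1 ht => h1 ((mem_frontier_frameMap_iff hu h (p := (t, g t)) ht).2 (Or.inl rfl))
    rw [e1, e2]; simp
  le_two_mul B hB hBm := by
    rw [chordMeasure_apply h hBm, volume_image_eq hu hΩ.isClosed h hB, two_mul]
    exact add_le_add (measure_mono subset_union_left) (measure_mono subset_union_right)
  image_le B hB hBm := by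
    rw [chordMeasure_apply h hBm, volume_image_eq hu hΩ.isClosed h hB]
    exact measure_union_le _ _
  le_of_injOn B hB hBm hinj := by
    -- No t in the open interval has both graph points in B: they have the same projection and are
    -- distinct as g t < f t. So the union is disjoint up to a null set and the two graph measures
    -- add.
    rw [chordMeasure_apply h hBm, volume_image_eq hu hΩ.isClosed h hB, measure_union₀]
    · exact (aemeasurable_graph u h.cont_bot).nullMeasurable hBm
    · rw [AEDisjoint, Measure.restrict_apply' measurableSet_Ioo]
      convert measure_empty (μ := volume)
      ext t
      simp only [mem_inter_iff, mem_preimage, mem_empty_iff_false, iff_false, not_and]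
      rintro ⟨h1, h2⟩ ht
      have e := hinj h1 h2 (by simp only [inner_self_frameMap hu])
      have := congrArg (fun x => inner ℝ (rot u) x) e
      simp only [inner_rot_frameMap hu] at this
      exact (h.lt_of_mem t ht).ne' this
  integral_comp := by
    refine ⟨a, b, h.lt, image_inner_eq hu h, fun φ hφ => ?_⟩
    rw [integral_chordMeasure h (by fun_prop), ← intervalIntegral.integral_const_mul]
    congr 1
    ext t
    simp only [inner_self_frameMap hu]; ring
  mean_le e m w hw hm := by
    have hb : ∀ p ∈ frameMap u ⁻¹' Ω,
        inner ℝ e u * p.1 + inner ℝ e (rot u) * p.2 ∈ Icc m (m + w) := fun p hp => by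
      have := hm _ hp
      rw [inner_frameMap] at this
      rwa [mul_comm, mul_comm _ p.2]
    have key := chord_mean_le_interval (α := inner ℝ e u) (β := inner ℝ e (rot u)) h.lt hw
      h.concave h.convex h.cont_top h.cont_bot h.le (fun t ht => hb _ (h.mem_bot ht))
      (fun t ht => hb _ (h.mem_top ht))
    have hpos := volume_body_pos hu hΩ h
    rw [← inner_bodyCentroid_mul hu hΩ h, ← volume_body hu hΩ h] at key
    have e1 : ∫ x, inner ℝ e x ∂(chordMeasure u a b g f) =
        ∫ t in a..b, (2 * inner ℝ e u * t + inner ℝ e (rot u) * (f t + g t)) := by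
      rw [integral_chordMeasure h (by fun_prop)]
      congr 1
      ext t
      simp only [inner_frameMap]; ring
    have e2 : (chordMeasure u a b g f).real univ = 2 * (b - a) := by
      rw [measureReal_def, chordMeasure_univ h, ENNReal.toReal_mul,
        ENNReal.toReal_ofReal (sub_nonneg.2 h.lt.le)]
      rfl
    rw [e1, e2]
    refine le_of_mul_le_mul_right ?_ hpos
    linarith

end

lemma exists_isChordMeasure {Ω : Set Plane} (hΩ : IsPlanarConvexBody Ω) {u : Plane}
    (hu : ‖u‖ = 1) : ∃ ν, IsChordMeasure Ω u ν := by
  have hK : IsCompact (frameMap u ⁻¹' Ω) :=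
    (frameHomeomorph hu).isCompact_preimage.2 hΩ.isCompact
  have hconv : Convex ℝ (frameMap u ⁻¹' Ω) := by
    intro p hp q hq s t hs ht hst
    have := hΩ.convex hp hq hs ht hst
    rw [mem_preimage]
    convert this using 1
    simp only [frameMap, Prod.fst_add, Prod.snd_add, Prod.smul_fst, Prod.smul_snd, smul_eq_mul]
    module
  have hint : (interior (frameMap u ⁻¹' Ω)).Nonempty := by
    have := (frameHomeomorph hu).preimage_interior Ω
    obtain ⟨x, hx⟩ := hΩ.nonempty_interior
    obtain ⟨p, rfl⟩ := (frameHomeomorph hu).surjective x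
    exact ⟨p, this ▸ hx⟩
  obtain ⟨a, b, g, f, h⟩ := exists_isGraphRegion hK hconv hint
  exact ⟨_, isChordMeasure_chordMeasure hu hΩ.isCompact h⟩

/-! ### Projections of nearly straight boundary pieces. -/

lemma volume_image_le {X : Type*} [MetricSpace X] [MeasurableSpace X] [BorelSpace X]
    {φ : X → ℝ} {B : Set X} {c : ℝ} (hc : 0 ≤ c)
    (h : ∀ x ∈ B, ∀ y ∈ B, |φ x - φ y| ≤ c * dist x y) :
    volume (φ '' B) ≤ ENNReal.ofReal c * μH[1] B := by
  have hL : LipschitzOnWith c.toNNReal φ B := LipschitzOnWith.of_dist_le_mul fun x hx y hy => by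
    rw [Real.dist_eq, Real.coe_toNNReal _ hc]; exact h x hx y hy
  have := hL.hausdorffMeasure_image_le zero_le_one
  rwa [hausdorffMeasure_real, ENNReal.rpow_one] at this

/-- For c > 0 the map φ is injective on B with an inverse that is Lipschitz with constant 1/c; for c
≤ 0 the left side is 0, because `ENNReal.ofReal` truncates. -/
lemma le_volume_image {X : Type*} [MetricSpace X] [MeasurableSpace X] [BorelSpace X]
    {φ : X → ℝ} {B : Set X} {c : ℝ}
    (h : ∀ x ∈ B, ∀ y ∈ B, c * dist x y ≤ |φ x - φ y|) :
    ENNReal.ofReal c * μH[1] B ≤ volume (φ '' B) := by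
  rcases le_or_gt c 0 with hc | hc
  · rw [ENNReal.ofReal_of_nonpos hc, zero_mul]; exact zero_le
  rcases B.eq_empty_or_nonempty with rfl | hne
  · simp
  have : Nonempty X := ⟨hne.some⟩
  have hinj : InjOn φ B := fun x hx y hy hxy => by
    have := h x hx y hy
    rw [hxy, sub_self, abs_zero] at this
    exact dist_le_zero.1 (nonpos_of_mul_nonpos_right this hc)
  have hinv : ∀ x ∈ B, Function.invFunOn φ B (φ x) = x := fun x hx =>
    hinj.leftInvOn_invFunOn hx
  have hL : LipschitzOnWith (c⁻¹).toNNReal (Function.invFunOn φ B) (φ '' B) := by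
    refine LipschitzOnWith.of_dist_le_mul ?_
    rintro _ ⟨x, hx, rfl⟩ _ ⟨y, hy, rfl⟩
    rw [hinv x hx, hinv y hy, Real.coe_toNNReal _ (inv_nonneg.2 hc.le), Real.dist_eq,
      inv_mul_eq_div, le_div_iff₀ hc, mul_comm]
    exact h x hx y hy
  have himg : Function.invFunOn φ B '' (φ '' B) = B := hinj.leftInvOn_invFunOn.image_image
  have key := hL.hausdorffMeasure_image_le zero_le_one
  rw [himg, hausdorffMeasure_real, ENNReal.rpow_one] at key
  calc ENNReal.ofReal c * μH[1] B
      ≤ ENNReal.ofReal c * (ENNReal.ofReal c⁻¹ * volume (φ '' B)) := by gcongr; exact key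
    _ = volume (φ '' B) := by
      rw [← mul_assoc, ← ENNReal.ofReal_mul hc.le, mul_inv_cancel₀ hc.ne', ENNReal.ofReal_one,
        one_mul]

/-- The set `B` is within angle `ε` of the direction orthogonal to `n`. -/
def IsFlat (B : Set Plane) (n : Plane) (ε : ℝ) : Prop :=
  ∀ x ∈ B, ∀ y ∈ B, |inner ℝ n (x - y)| ≤ ε * dist x y

lemma IsFlat.mono {B C : Set Plane} {n : Plane} {ε : ℝ} (h : IsFlat C n ε) (hB : B ⊆ C) :
    IsFlat B n ε := fun x hx y hy => h x (hB hx) y (hB hy)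

/-- Decompose x - y along n and `rot n`. The component along n is at most ε · dist x y, so the
projection to u is governed by the tangential component. One ε in the lower bound is lost in
replacing |⟨rot n, x - y⟩| by dist x y, the other in the normal term. -/
lemma IsFlat.inner_bounds {B : Set Plane} {u n : Plane} {ε : ℝ} (hB : IsFlat B n ε)
    (hu : ‖u‖ = 1) (hn : ‖n‖ = 1) {x y : Plane} (hx : x ∈ B) (hy : y ∈ B) :
    |inner ℝ u x - inner ℝ u y| ≤ (|inner ℝ u (rot n)| + ε) * dist x y ∧
    (|inner ℝ u (rot n)| - 2 * ε) * dist x y ≤ |inner ℝ u x - inner ℝ u y| := by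
  have h1 := hB x hx y hy
  rw [← inner_sub_right]
  rw [dist_eq_norm] at *
  set d := x - y
  have e1 := inner_expand hn u d
  have e2 := inner_expand hn d d
  have hun : |inner ℝ u n| ≤ 1 := by
    simpa [hu, hn] using abs_real_inner_le_norm u n
  have huτ : |inner ℝ u (rot n)| ≤ 1 := by
    simpa [hu, hn, norm_rot] using abs_real_inner_le_norm u (rot n)
  have hτd : |inner ℝ (rot n) d| ≤ ‖d‖ := by
    simpa [hn, norm_rot] using abs_real_inner_le_norm (rot n) d
  have hτd' : ‖d‖ ≤ |inner ℝ (rot n) d| + |inner ℝ n d| := by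
    rw [real_inner_self_eq_norm_sq, real_inner_comm n d, real_inner_comm (rot n) d] at e2
    refine abs_le_of_sq_le_sq' ?_ (by positivity) |>.2
    have := mul_nonneg (abs_nonneg (inner ℝ (rot n) d)) (abs_nonneg (inner ℝ n d))
    rw [add_sq, sq_abs, sq_abs, e2]
    linarith
  have p1 : |inner ℝ u n * inner ℝ n d| ≤ ε * ‖d‖ := by
    rw [abs_mul]
    calc _ ≤ 1 * |inner ℝ n d| := mul_le_mul_of_nonneg_right hun (abs_nonneg _)
      _ ≤ _ := by rwa [one_mul]
  have p2 : |inner ℝ u (rot n) * inner ℝ (rot n) d| ≤ |inner ℝ u (rot n)| * ‖d‖ := by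
    rw [abs_mul]; exact mul_le_mul_of_nonneg_left hτd (abs_nonneg _)
  have p3 : (|inner ℝ u (rot n)| - ε) * ‖d‖ ≤ |inner ℝ u (rot n) * inner ℝ (rot n) d| := by
    rw [abs_mul]
    have q1 := mul_le_mul_of_nonneg_left hτd' (abs_nonneg (inner ℝ u (rot n)))
    have q2 := mul_le_mul_of_nonneg_right huτ (abs_nonneg (inner ℝ n d))
    linarith
  rw [e1]
  constructor
  · refine (abs_add_le _ _).trans ?_
    linarith
  · have := abs_sub_abs_le_abs_sub (inner ℝ u (rot n) * inner ℝ (rot n) d)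
      (-(inner ℝ u n * inner ℝ n d))
    rw [abs_neg, sub_neg_eq_add, add_comm (inner ℝ u (rot n) * inner ℝ (rot n) d)] at this
    linarith

/-- On a nearly straight part of the boundary the chord measure is nearly proportional to arc
length. -/
lemma IsChordMeasure.bounds {Ω : Set Plane} {u n : Plane} {ν : Measure Plane} {ε : ℝ}
    {B : Set Plane} (hν : IsChordMeasure Ω u ν) (hu : ‖u‖ = 1) (hn : ‖n‖ = 1) (hε : 0 ≤ ε)
    (hBΩ : B ⊆ frontier Ω) (hBm : MeasurableSet B) (hB : IsFlat B n ε) :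
    ν B ≤ ENNReal.ofReal (|inner ℝ u (rot n)| + 4 * ε) * μH[1] B ∧
    ENNReal.ofReal (|inner ℝ u (rot n)| - 2 * ε) * μH[1] B ≤ ν B := by
  have up : volume ((fun x => inner ℝ u x) '' B) ≤
      ENNReal.ofReal (|inner ℝ u (rot n)| + ε) * μH[1] B :=
    volume_image_le (by positivity) fun x hx y hy => (hB.inner_bounds hu hn hx hy).1
  have low : ENNReal.ofReal (|inner ℝ u (rot n)| - 2 * ε) * μH[1] B ≤
      volume ((fun x => inner ℝ u x) '' B) :=
    le_volume_image fun x hx y hy => (hB.inner_bounds hu hn hx hy).2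
  refine ⟨?_, low.trans (hν.image_le B hBΩ hBm)⟩
  -- If |⟨u, rot n⟩| ≤ 2ε the projection may fail to be injective on B, but the crude factor 2 is
  -- affordable: 2(c + ε) ≤ c + 4ε for c ≤ 2ε. Otherwise the lower Lipschitz bound makes it
  -- injective.
  rcases le_or_gt |inner ℝ u (rot n)| (2 * ε) with h | h
  · calc ν B ≤ 2 * volume ((fun x => inner ℝ u x) '' B) := hν.le_two_mul B hBΩ hBm
      _ ≤ 2 * (ENNReal.ofReal (|inner ℝ u (rot n)| + ε) * μH[1] B) := by gcongr
      _ = ENNReal.ofReal (2 * (|inner ℝ u (rot n)| + ε)) * μH[1] B := by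
        rw [ENNReal.ofReal_mul zero_le_two, ENNReal.ofReal_ofNat, mul_assoc]
      _ ≤ _ := by gcongr; linarith
  · have hinj : InjOn (fun x => inner ℝ u x) B := fun x hx y hy hxy => by
      have := (hB.inner_bounds hu hn hx hy).2
      dsimp only at hxy
      rw [hxy, sub_self, abs_zero] at this
      exact dist_le_zero.1 (nonpos_of_mul_nonpos_right this (by linarith))
    refine (hν.le_of_injOn B hBΩ hBm hinj).trans (up.trans ?_)
    gcongr; linarith

/-- Hahn–Banach separates x from the interior of Ω, whose closure contains Ω. -/
lemma exists_unit_normal {Ω : Set Plane} (hΩ : IsPlanarConvexBody Ω) {x : Plane}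
    (hx : x ∈ frontier Ω) : ∃ n : Plane, ‖n‖ = 1 ∧ ∀ y ∈ Ω, inner ℝ n (y - x) ≤ 0 := by
  obtain ⟨φ, hφ⟩ := geometric_hahn_banach_open_point hΩ.convex.interior isOpen_interior hx.2
  set n := (InnerProductSpace.toDual ℝ Plane).symm φ with hn
  have hnφ : ∀ y, inner ℝ n y = φ y := fun y => InnerProductSpace.toDual_symm_apply
  have hle : ∀ y ∈ Ω, φ y ≤ φ x := fun y hy => by
    have hy' : y ∈ closure (interior Ω) := by
      rw [hΩ.convex.closure_interior_eq_closure_of_nonempty_interior hΩ.nonempty_interior]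
      exact subset_closure hy
    exact closure_minimal (fun z hz => (hφ z hz).le)
      (isClosed_le φ.continuous continuous_const) hy'
  have hn0 : n ≠ 0 := fun h0 => by
    obtain ⟨z, hz⟩ := hΩ.nonempty_interior
    have := hφ z hz
    rw [← hnφ, ← hnφ, h0] at this
    simp at this
  refine ⟨‖n‖⁻¹ • n, norm_smul_inv_norm hn0, fun y hy => ?_⟩
  rw [real_inner_smul_left, inner_sub_right, hnφ, hnφ]
  exact mul_nonpos_of_nonneg_of_nonpos (by positivity) (sub_nonpos.2 (hle y hy))

/-- The boundary of a convex body is the disjoint union of countably many nearly straight pieces. -/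
lemma exists_flat_pieces {Ω : Set Plane} (hΩ : IsPlanarConvexBody Ω) {ε : ℝ} (hε : 0 < ε) :
    ∃ (D : ℕ → Set Plane) (n : ℕ → Plane), (∀ i, ‖n i‖ = 1) ∧ Pairwise (Function.onFun Disjoint D) ∧
      (∀ i, MeasurableSet (D i)) ∧ ⋃ i, D i = frontier Ω ∧ ∀ i, IsFlat (D i) (n i) ε := by
  have hne : Nonempty (Metric.sphere (0 : Plane) 1) :=
    (NormedSpace.sphere_nonempty.2 zero_le_one).to_subtype
  set n : ℕ → Plane := fun i => TopologicalSpace.denseSeq (Metric.sphere (0 : Plane) 1) i with hn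
  have hn1 : ∀ i, ‖n i‖ = 1 := fun i =>
    mem_sphere_zero_iff_norm.1 (TopologicalSpace.denseSeq (Metric.sphere (0 : Plane) 1) i).2
  have hcf : IsCompact (frontier Ω) :=
    hΩ.isCompact.of_isClosed_subset isClosed_frontier hΩ.isCompact.isClosed.frontier_subset
  -- Pairs of a boundary point and an outer normal within ε of `n i`. These sets are compact, so
  -- their projections `A i` to the boundary are compact and hence measurable.
  set P : ℕ → Set (Plane × Plane) := fun i => (frontier Ω ×ˢ Metric.closedBall (n i) ε) ∩
    {p | ∀ y ∈ Ω, inner ℝ p.2 (y - p.1) ≤ 0} with hP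
  have hPc : ∀ i, IsCompact (P i) := fun i => by
    refine (hcf.prod (isCompact_closedBall _ _)).inter_right ?_
    simp only [ofPred_forall]
    exact isClosed_iInter fun y => isClosed_iInter fun _ =>
      isClosed_le (by fun_prop) continuous_const
  set A : ℕ → Set Plane := fun i => Prod.fst '' P i with hA
  have hAm : ∀ i, MeasurableSet (A i) := fun i =>
    ((hPc i).image continuous_fst).isClosed.measurableSet
  have hAf : ∀ i, IsFlat (A i) (n i) ε := by
    rintro i _ ⟨⟨x, p⟩, ⟨⟨hx, hp⟩, hxp⟩, rfl⟩ _ ⟨⟨y, q⟩, ⟨⟨hy, hq⟩, hyq⟩, rfl⟩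
    dsimp only at *
    have hxΩ := hΩ.isCompact.isClosed.frontier_subset hx
    have hyΩ := hΩ.isCompact.isClosed.frontier_subset hy
    -- With p normal at x and q normal at y, ⟨q, x - y⟩ ≤ 0 ≤ ⟨p, x - y⟩; both p and q are within ε
    -- of `n i`, which squeezes ⟨n i, x - y⟩ from both sides.
    have h1 : inner ℝ q (x - y) ≤ 0 := hyq x hxΩ
    have h2 : inner ℝ p (y - x) ≤ 0 := hxp y hyΩ
    rw [← neg_sub x y, inner_neg_right] at h2
    have h3 : ∀ p' ∈ Metric.closedBall (n i) ε,
        |inner ℝ (n i) (x - y) - inner ℝ p' (x - y)| ≤ ε * dist x y := fun p' hp' => by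
      rw [← inner_sub_left, dist_eq_norm]
      refine (abs_real_inner_le_norm _ _).trans (mul_le_mul_of_nonneg_right ?_ (norm_nonneg _))
      rw [← dist_eq_norm, dist_comm]; exact hp'
    have h4 := abs_le.1 (h3 p hp)
    have h5 := abs_le.1 (h3 q hq)
    rw [abs_le]
    constructor <;> linarith [h4.1, h5.2]
  refine ⟨disjointed A, n, hn1, disjoint_disjointed A, MeasurableSet.disjointed hAm, ?_,
    fun i => (hAf i).mono (disjointed_subset A i)⟩
  rw [iUnion_disjointed]
  refine Subset.antisymm (iUnion_subset ?_) fun x hx => ?_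
  · rintro i _ ⟨p, hp, rfl⟩
    exact hp.1.1
  · obtain ⟨p, hp1, hp⟩ := exists_unit_normal hΩ hx
    obtain ⟨i, hi⟩ := (TopologicalSpace.denseRange_denseSeq
      (Metric.sphere (0 : Plane) 1)).exists_dist_lt ⟨p, by simpa using hp1⟩ hε
    exact mem_iUnion.2 ⟨i, (x, p), ⟨⟨hx, le_of_lt hi⟩, hp⟩, rfl⟩

lemma measure_le_of_pieces {X : Type*} [MeasurableSpace X] {μ ν : Measure X} {D : ℕ → Set X}
    (hd : Pairwise (Function.onFun Disjoint D)) (hm : ∀ i, MeasurableSet (D i)) {B : Set X}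
    (hB : MeasurableSet B) (hBD : B ⊆ ⋃ i, D i) (h : ∀ i, μ (B ∩ D i) ≤ ν (B ∩ D i)) :
    μ B ≤ ν B := by
  have e : B = ⋃ i, B ∩ D i := by rw [← inter_iUnion, inter_eq_left.2 hBD]
  have hd' : Pairwise (Function.onFun Disjoint fun i => B ∩ D i) := fun i j hij =>
    (hd hij).mono inter_subset_right inter_subset_right
  rw [e, measure_iUnion hd' fun i => hB.inter (hm i), measure_iUnion hd' fun i => hB.inter (hm i)]
  exact ENNReal.tsum_le_tsum h

/-! ### A discrete Cauchy–Crofton formula. -/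

lemma integral_abs_cos_sub (φ : ℝ) : ∫ x in (0 : ℝ)..Real.pi, |Real.cos (x - φ)| = 2 := by
  have hper : Function.Periodic (fun x => |Real.cos x|) Real.pi := fun x => by
    simp [Real.cos_add_pi]
  rw [intervalIntegral.integral_comp_sub_right (fun x => |Real.cos x|)]
  have h1 := hper.intervalIntegral_add_eq (0 - φ) (-(Real.pi / 2))
  rw [show 0 - φ + Real.pi = Real.pi - φ by ring,
    show -(Real.pi / 2) + Real.pi = Real.pi / 2 by ring] at h1
  rw [h1, intervalIntegral.integral_congr (g := Real.cos), integral_cos]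
  · simp; norm_num
  · intro x hx
    rw [uIcc_of_le (by linarith [Real.pi_pos])] at hx
    exact abs_of_nonneg (Real.cos_nonneg_of_mem_Icc hx)

/-- With step h = π/K, h times the sum is a Riemann sum for an integral equal to 2. As |cos| is
1-Lipschitz, the error is at most K h² = π h, and division by h leaves π, uniformly in φ and K. -/
lemma abs_sum_abs_cos_sub_le {K : ℕ} (hK : 0 < K) (φ : ℝ) :
    |∑ k ∈ Finset.range K, |Real.cos (k * (Real.pi / K) - φ)| - 2 * K / Real.pi| ≤ Real.pi := by
  have hKr : (0 : ℝ) < K := Nat.cast_pos.2 hK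
  set h := Real.pi / K with hh
  have hpos : 0 < h := div_pos Real.pi_pos hKr
  have hcont : Continuous fun x => |Real.cos (x - φ)| := by fun_prop
  have hsum := intervalIntegral.sum_integral_adjacent_intervals (μ := volume)
    (f := fun x => |Real.cos (x - φ)|) (a := fun k : ℕ => (k : ℝ) * h) (n := K)
    fun k _ => hcont.intervalIntegrable _ _
  rw [Nat.cast_zero, zero_mul, show (K : ℝ) * h = Real.pi by rw [hh]; field_simp,
    integral_abs_cos_sub] at hsum
  have hloc : ∀ k : ℕ, |(∫ x in ((k : ℝ) * h)..((k + 1 : ℕ) : ℝ) * h, |Real.cos (x - φ)|) -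
      h * (|Real.cos (k * h - φ)|)| ≤ h * h := fun k => by
    have e : (∫ x in ((k : ℝ) * h)..((k + 1 : ℕ) : ℝ) * h, |Real.cos (x - φ)|) -
        h * |Real.cos (k * h - φ)| = ∫ x in ((k : ℝ) * h)..((k + 1 : ℕ) : ℝ) * h,
          (|Real.cos (x - φ)| - |Real.cos (k * h - φ)|) := by
      rw [intervalIntegral.integral_sub (hcont.intervalIntegrable _ _) (by simp)]
      simp only [intervalIntegral.integral_const, smul_eq_mul]
      push_cast; ring
    have hle : (k : ℝ) * h ≤ ((k + 1 : ℕ) : ℝ) * h := by push_cast; nlinarith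
    rw [e]
    refine (intervalIntegral.norm_integral_le_of_norm_le_const (E := ℝ) (C := h) fun x hx => ?_).trans ?_
    · rw [uIoc_of_le hle] at hx
      push_cast at hx
      rw [Real.norm_eq_abs]
      refine (abs_abs_sub_abs_le_abs_sub _ _).trans ((Real.abs_cos_sub_cos_le _ _).trans ?_)
      rw [abs_le]; constructor <;> linarith [hx.1, hx.2]
    · rw [abs_of_nonneg (sub_nonneg.2 hle)]; push_cast; linarith
  have h2 : |2 - h * ∑ k ∈ Finset.range K, (|Real.cos (k * h - φ)|)| ≤ K * (h * h) := by
    rw [← hsum, Finset.mul_sum, ← Finset.sum_sub_distrib]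
    refine (Finset.abs_sum_le_sum_abs _ _).trans ((Finset.sum_le_sum fun k _ => hloc k).trans ?_)
    simp
  set S := ∑ k ∈ Finset.range K, |Real.cos (k * h - φ)|
  have e1 : S - 2 * K / Real.pi = -(2 - h * S) / h := by
    rw [hh]; field_simp [Real.pi_pos.ne']; ring
  rw [e1, abs_div, abs_neg, abs_of_pos hpos, div_le_iff₀ hpos]
  refine h2.trans (le_of_eq ?_)
  rw [hh]; field_simp

/-- The unit vector of angle `k * π / K`. -/
noncomputable def dir (K k : ℕ) : Plane :=
  !₂[Real.cos (k * (Real.pi / K)), Real.sin (k * (Real.pi / K))]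

lemma norm_dir (K k : ℕ) : ‖dir K k‖ = 1 := by
  rw [norm_eq_one_iff]
  simp [dir]

lemma abs_sum_abs_inner_dir_sub_le {K : ℕ} (hK : 0 < K) {τ : Plane} (hτ : ‖τ‖ = 1) :
    |∑ k ∈ Finset.range K, |inner ℝ (dir K k) τ| - 2 * K / Real.pi| ≤ Real.pi := by
  have hz : ‖(⟨τ 0, τ 1⟩ : ℂ)‖ = 1 := by
    rw [norm_eq_one_iff] at hτ
    rw [Complex.norm_def, Complex.normSq_apply, Real.sqrt_eq_one]
    linarith
  set φ := Complex.arg ⟨τ 0, τ 1⟩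
  have h0 : τ 0 = Real.cos φ := by
    have := Complex.norm_mul_cos_arg ⟨τ 0, τ 1⟩
    rw [hz, one_mul] at this
    exact this.symm
  have h1 : τ 1 = Real.sin φ := by
    have := Complex.norm_mul_sin_arg ⟨τ 0, τ 1⟩
    rw [hz, one_mul] at this
    exact this.symm
  have e : ∀ k, inner ℝ (dir K k) τ = Real.cos (k * (Real.pi / K) - φ) := fun k => by
    rw [inner_eq, h0, h1, Real.cos_sub]; rfl
  simp only [e]
  exact abs_sum_abs_cos_sub_le hK φ

lemma ofReal_sum_le {ι : Type*} (s : Finset ι) (f : ι → ℝ) :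
    ENNReal.ofReal (∑ i ∈ s, f i) ≤ ∑ i ∈ s, ENNReal.ofReal (f i) := by
  classical
  induction s using Finset.induction_on with
  | empty => simp
  | insert i s hi ih =>
    rw [Finset.sum_insert hi, Finset.sum_insert hi]
    exact ENNReal.ofReal_add_le.trans (add_le_add le_rfl ih)

/-- A finite average version of the Cauchy-Crofton formula: a sum of `K` chord measures is nearly
proportional to arc length. -/
lemma exists_crofton {Ω : Set Plane} (hΩ : IsPlanarConvexBody Ω) {K : ℕ} (hK : 0 < K) :
    ∃ S : Measure Plane, IsFiniteMeasure S ∧ S (frontier Ω)ᶜ = 0 ∧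
      (∀ B ⊆ frontier Ω, MeasurableSet B →
        ENNReal.ofReal (2 * K / Real.pi - 8) * μH[1] B ≤ S B ∧
        S B ≤ ENNReal.ofReal (2 * K / Real.pi + 8) * μH[1] B) ∧
      ∀ (e : Plane) (m w : ℝ), 0 < w → (∀ x ∈ Ω, inner ℝ e x ∈ Icc m (m + w)) →
        ∫ x, inner ℝ e x ∂S ≤ (inner ℝ e (bodyCentroid Ω) + w / 6) * S.real univ := by
  choose ν hν using fun k => exists_isChordMeasure hΩ (norm_dir K k)
  have hfin : ∀ k, IsFiniteMeasure (ν k) := fun k => (hν k).finite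
  have hKr : (0 : ℝ) < K := Nat.cast_pos.2 hK
  -- The tolerance 1/K makes the K errors, each at most 4/K, sum to at most 4; together with the
  -- Riemann sum error π < 4 this gives the constant 8.
  obtain ⟨D, n, hn, hd, hm, hU, hflat⟩ := exists_flat_pieces hΩ (inv_pos.2 hKr)
  have hcl : ∀ k, ν k (frontier Ω)ᶜ = 0 := fun k => (hν k).compl
  refine ⟨∑ k ∈ Finset.range K, ν k, inferInstance, ?_, fun B hB hBm => ?_, fun e m w hw hx => ?_⟩
  · rw [Measure.finsetSum_apply]
    exact Finset.sum_eq_zero fun k _ => hcl k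
  · have piece : ∀ i, ENNReal.ofReal (2 * K / Real.pi - 8) * μH[1] (B ∩ D i) ≤
        (∑ k ∈ Finset.range K, ν k) (B ∩ D i) ∧ (∑ k ∈ Finset.range K, ν k) (B ∩ D i) ≤
          ENNReal.ofReal (2 * K / Real.pi + 8) * μH[1] (B ∩ D i) := fun i => by
      have hb := fun k => (hν k).bounds (norm_dir K k) (hn i) (inv_pos.2 hKr).le
        (inter_subset_left.trans hB) (hBm.inter (hm i)) ((hflat i).mono inter_subset_right)
      have hs := abs_le.1 (abs_sum_abs_inner_dir_sub_le hK
        (τ := rot (n i)) (by rw [norm_rot]; exact hn i))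
      have hpi := Real.pi_lt_four
      rw [Measure.finsetSum_apply]
      constructor
      · refine le_trans ?_ (Finset.sum_le_sum fun k _ => (hb k).2)
        rw [← Finset.sum_mul]
        gcongr
        refine le_trans (ENNReal.ofReal_le_ofReal ?_) (ofReal_sum_le _ _)
        rw [Finset.sum_sub_distrib]
        have : ∑ _k ∈ Finset.range K, 2 * (K : ℝ)⁻¹ = 2 := by
          rw [Finset.sum_const, Finset.card_range, nsmul_eq_mul]; field_simp
        rw [this]
        linarith [hs.1]
      · refine (Finset.sum_le_sum fun k _ => (hb k).1).trans ?_
        rw [← Finset.sum_mul, ← ENNReal.ofReal_sum_of_nonneg fun k _ => by positivity]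
        gcongr
        rw [Finset.sum_add_distrib]
        have : ∑ _k ∈ Finset.range K, 4 * (K : ℝ)⁻¹ = 4 := by
          rw [Finset.sum_const, Finset.card_range, nsmul_eq_mul]; field_simp
        rw [this]
        linarith [hs.2]
    have hBU : B ⊆ ⋃ i, D i := hU ▸ hB
    have e : ∀ (c : ENNReal) (A : Set Plane),
        c * (μH[1] : Measure Plane) A = (c • (μH[1] : Measure Plane)) A := fun c A => rfl
    simp only [e] at piece ⊢
    exact ⟨measure_le_of_pieces hd hm hBm hBU fun i => (piece i).1,
      measure_le_of_pieces hd hm hBm hBU fun i => (piece i).2⟩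
  · have hint : ∀ k ∈ Finset.range K, Integrable (fun x => inner ℝ e x) (ν k) := fun k _ => by
      refine Integrable.of_mem_Icc m (m + w) (by fun_prop) ?_
      rw [ae_iff]
      refine measure_mono_null (fun x hx' => ?_) (hcl k)
      exact fun hxF => hx' (hx x (hΩ.isCompact.isClosed.frontier_subset hxF))
    rw [integral_finsetSum_measure hint]
    have : (∑ k ∈ Finset.range K, ν k).real univ = ∑ k ∈ Finset.range K, (ν k).real univ := by
      simp only [measureReal_def, Measure.finsetSum_apply]
      exact ENNReal.toReal_sum fun k _ => measure_ne_top _ _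
    rw [this, Finset.mul_sum]
    exact Finset.sum_le_sum fun k _ => (hν k).mean_le e m w hw hx

/-! ### Finiteness of the perimeter and its comparison with the diameter. -/

/-- For K = 16 the lower Crofton constant 32/π - 8 is at least 1, so the perimeter is bounded by the
mass of a finite measure. -/
lemma hausdorffMeasure_frontier_lt_top {Ω : Set Plane} (hΩ : IsPlanarConvexBody Ω) :
    μH[1] (frontier Ω) < ⊤ := by
  obtain ⟨S, hS, -, hb, -⟩ := exists_crofton hΩ (K := 16) (by norm_num)
  have h1 := (hb _ Subset.rfl isClosed_frontier.measurableSet).1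
  have h2 : (1 : ENNReal) ≤ ENNReal.ofReal (2 * (16 : ℕ) / Real.pi - 8) := by
    rw [ENNReal.one_le_ofReal, le_sub_iff_add_le, le_div_iff₀ Real.pi_pos]
    push_cast
    linarith [Real.pi_lt_d2]
  calc μH[1] (frontier Ω) = 1 * μH[1] (frontier Ω) := (one_mul _).symm
    _ ≤ ENNReal.ofReal (2 * (16 : ℕ) / Real.pi - 8) * μH[1] (frontier Ω) := by gcongr
    _ ≤ S (frontier Ω) := h1
    _ < ⊤ := measure_lt_top _ _

/-- On pieces of flatness ε the density of ν is at most |⟨u, rot n⟩| + 4ε ≤ 1 + 4ε. Finiteness of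
the length of B permits ε → 0. -/
lemma IsChordMeasure.le_hausdorffMeasure {Ω : Set Plane} (hΩ : IsPlanarConvexBody Ω) {u : Plane}
    (hu : ‖u‖ = 1) {ν : Measure Plane} (hν : IsChordMeasure Ω u ν) {B : Set Plane}
    (hB : B ⊆ frontier Ω) (hBm : MeasurableSet B) : ν B ≤ μH[1] B := by
  have hfin : μH[1] B ≠ ⊤ :=
    ((measure_mono hB).trans_lt (hausdorffMeasure_frontier_lt_top hΩ)).ne
  have key : ∀ ε > 0, ν B ≤ ENNReal.ofReal (1 + 4 * ε) * μH[1] B := fun ε hε => by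
    obtain ⟨D, n, hn, hd, hm, hU, hflat⟩ := exists_flat_pieces hΩ hε
    refine measure_le_of_pieces (ν := ENNReal.ofReal (1 + 4 * ε) • μH[1]) hd hm hBm (hU ▸ hB)
      fun i => ?_
    refine ((hν.bounds hu (hn i) hε.le (inter_subset_left.trans hB) (hBm.inter (hm i))
      ((hflat i).mono inter_subset_right)).1).trans ?_
    rw [Measure.smul_apply, smul_eq_mul]
    gcongr
    simpa [hu, hn i, norm_rot] using abs_real_inner_le_norm u (rot (n i))
  have ht : Tendsto (fun ε : ℝ => ENNReal.ofReal (1 + 4 * ε) * μH[1] B) (𝓝[>] 0)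
      (𝓝 (ENNReal.ofReal (1 + 4 * 0) * μH[1] B)) := by
    refine ENNReal.Tendsto.mul_const (ENNReal.tendsto_ofReal ?_) (Or.inr hfin)
    exact ((by fun_prop : Continuous fun ε : ℝ => 1 + 4 * ε).tendsto 0).mono_left
      nhdsWithin_le_nhds
  have := ge_of_tendsto ht (by filter_upwards [self_mem_nhdsWithin] with ε hε using key ε hε)
  simpa using this

lemma IsChordMeasure.le_restrict {Ω : Set Plane} (hΩ : IsPlanarConvexBody Ω) {u : Plane}
    (hu : ‖u‖ = 1) {ν : Measure Plane} (hν : IsChordMeasure Ω u ν) :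
    ν ≤ (μH[1] : Measure Plane).restrict (frontier Ω) := by
  have hF : MeasurableSet (frontier Ω) := isClosed_frontier.measurableSet
  refine Measure.le_iff.2 fun B hB => ?_
  rw [Measure.restrict_apply hB, ← measure_inter_add_sdiff B hF]
  have : ν (B \ frontier Ω) = 0 := measure_mono_null (fun x hx => hx.2) hν.compl
  rw [this, add_zero]
  exact hν.le_hausdorffMeasure hΩ hu inter_subset_right (hB.inter hF)

/-- For u along x - y the chord measure has mass twice the width of Ω in direction u, which is at
least 2 · dist x y, and it is at most arc length. -/
lemma two_mul_dist_le_boundaryLength {Ω : Set Plane} (hΩ : IsPlanarConvexBody Ω) {x y : Plane}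
    (hx : x ∈ Ω) (hy : y ∈ Ω) : 2 * dist x y ≤ boundaryLength Ω := by
  rcases eq_or_ne x y with rfl | hxy
  · simp [boundaryLength, measureReal_nonneg]
  have hd : 0 < ‖x - y‖ := norm_pos_iff.2 (sub_ne_zero.2 hxy)
  set u := ‖x - y‖⁻¹ • (x - y) with hu
  have hu1 : ‖u‖ = 1 := norm_smul_inv_norm (sub_ne_zero.2 hxy)
  obtain ⟨ν, hν⟩ := exists_isChordMeasure hΩ hu1
  have := hν.finite
  obtain ⟨a, b, hab, himg, hφ⟩ := hν.integral_comp
  have h1 := hφ (fun _ => 1) continuous_const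
  simp only [integral_const, smul_eq_mul, mul_one, intervalIntegral.integral_const] at h1
  have hxI : inner ℝ u x ∈ Icc a b := himg ▸ ⟨x, hx, rfl⟩
  have hyI : inner ℝ u y ∈ Icc a b := himg ▸ ⟨y, hy, rfl⟩
  have h2 : inner ℝ u x - inner ℝ u y = ‖x - y‖ := by
    rw [← inner_sub_right, hu, real_inner_smul_left, real_inner_self_eq_norm_sq]
    field_simp
  have h3 : ν.real univ ≤ boundaryLength Ω := by
    have h4 : ν univ ≤ μH[1] (frontier Ω) := by
      have := hν.le_restrict hΩ hu1 univ
      rwa [Measure.restrict_apply_univ] at this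
    exact ENNReal.toReal_mono (hausdorffMeasure_frontier_lt_top hΩ).ne h4
  rw [dist_eq_norm]
  linarith [hxI.2, hyI.1]

lemma exists_ne_of_isPlanarConvexBody {Ω : Set Plane} (hΩ : IsPlanarConvexBody Ω) :
    ∃ x ∈ Ω, ∃ y ∈ Ω, x ≠ y := by
  obtain ⟨x, hx⟩ := hΩ.nonempty_interior
  obtain ⟨ε, hε, hb⟩ := Metric.isOpen_iff.1 isOpen_interior x hx
  obtain ⟨y, hy⟩ := NormedSpace.sphere_nonempty (x := x) (r := ε / 2) |>.2 (by positivity)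
  refine ⟨x, interior_subset hx, y, interior_subset (hb ?_), ?_⟩
  · rw [Metric.mem_sphere] at hy
    rw [Metric.mem_ball, hy]; linarith
  · rintro rfl
    rw [Metric.mem_sphere, dist_self] at hy
    linarith

lemma diam_pos {Ω : Set Plane} (hΩ : IsPlanarConvexBody Ω) : 0 < Metric.diam Ω := by
  obtain ⟨x, hx, y, hy, hxy⟩ := exists_ne_of_isPlanarConvexBody hΩ
  exact (dist_pos.2 hxy).trans_le (Metric.dist_le_diam_of_mem hΩ.isCompact.isBounded hx hy)

lemma two_mul_diam_le_boundaryLength {Ω : Set Plane} (hΩ : IsPlanarConvexBody Ω) :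
    2 * Metric.diam Ω ≤ boundaryLength Ω := by
  have : Metric.diam Ω ≤ boundaryLength Ω / 2 := by
    refine Metric.diam_le_of_forall_dist_le
      (div_nonneg measureReal_nonneg zero_le_two) fun x hx y hy => ?_
    linarith [two_mul_dist_le_boundaryLength hΩ hx hy]
  linarith

lemma boundaryLength_pos {Ω : Set Plane} (hΩ : IsPlanarConvexBody Ω) : 0 < boundaryLength Ω := by
  linarith [diam_pos hΩ, two_mul_diam_le_boundaryLength hΩ]

lemma isFiniteMeasure_boundary {Ω : Set Plane} (hΩ : IsPlanarConvexBody Ω) :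
    IsFiniteMeasure ((μH[1] : Measure Plane).restrict (frontier Ω)) :=
  ⟨by rw [Measure.restrict_apply_univ]; exact hausdorffMeasure_frontier_lt_top hΩ⟩

lemma integrableOn_frontier {Ω : Set Plane} (hΩ : IsPlanarConvexBody Ω) {F : Type*}
    [NormedAddCommGroup F] {φ : Plane → F} (hφ : Continuous φ) :
    IntegrableOn φ (frontier Ω) (μH[1] : Measure Plane) := by
  have hcf : IsCompact (frontier Ω) :=
    hΩ.isCompact.of_isClosed_subset isClosed_frontier hΩ.isCompact.isClosed.frontier_subset
  have := isFiniteMeasure_boundary hΩ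
  have h := (hφ.continuousOn (s := frontier Ω)).integrableOn_compact
    (μ := (μH[1] : Measure Plane).restrict (frontier Ω)) hcf
  rwa [IntegrableOn, Measure.restrict_restrict isClosed_frontier.measurableSet, inter_self] at h

/-! ### The upper bound for the distance of the centroids. -/

lemma inner_boundaryCentroid {Ω : Set Plane} (hΩ : IsPlanarConvexBody Ω) (e : Plane) :
    inner ℝ e (boundaryCentroid Ω) =
      (boundaryLength Ω)⁻¹ * ∫ x in frontier Ω, inner ℝ e x ∂(μH[1] : Measure Plane) := by
  rw [boundaryCentroid, inner_smul_right,
    ← integral_inner (integrableOn_frontier hΩ continuous_id : IntegrableOn (fun x => x) _ _)]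

/-- The mean inequality passes from the Crofton sums to arc length as the number K of directions
tends to infinity. -/
lemma integral_inner_frontier_le {Ω : Set Plane} (hΩ : IsPlanarConvexBody Ω) {e : Plane}
    {m w : ℝ} (hw : 0 < w) (hm : ∀ x ∈ Ω, inner ℝ e x ∈ Icc m (m + w)) :
    ∫ x in frontier Ω, inner ℝ e x ∂(μH[1] : Measure Plane) ≤
      (inner ℝ e (bodyCentroid Ω) + w / 6) * boundaryLength Ω := by
  have hF : MeasurableSet (frontier Ω) := isClosed_frontier.measurableSet
  have := isFiniteMeasure_boundary hΩ
  have hFΩ := hΩ.isCompact.isClosed.frontier_subset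
  set L := boundaryLength Ω with hL
  set C := inner ℝ e (bodyCentroid Ω) - m + w / 6 with hC
  -- Subtracting m makes the integrand nonnegative, so that a comparison of measures yields a
  -- comparison of integrals.
  set X := ∫ x in frontier Ω, (inner ℝ e x - m) ∂(μH[1] : Measure Plane) with hX
  have hXe : X = (∫ x in frontier Ω, inner ℝ e x ∂(μH[1] : Measure Plane)) - m * L := by
    rw [hX, integral_sub (integrableOn_frontier hΩ (by fun_prop)) (integrable_const _)]
    simp [measureReal_def, hL, boundaryLength, mul_comm]
  have hLtop : ∀ B ⊆ frontier Ω, (μH[1] : Measure Plane) B ≠ ⊤ := fun B hB =>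
    ((measure_mono hB).trans_lt (hausdorffMeasure_frontier_lt_top hΩ)).ne
  -- With κ = 2K/π, the lower Crofton bound gives (κ - 8) X ≤ C · S(univ), and S(univ) is within 8L
  -- of κL. The right side does not depend on K, so X - C L cannot be positive.
  have key : ∀ K : ℕ, 8 < 2 * K / Real.pi → (2 * K / Real.pi) * (X - C * L) ≤
      8 * (X + |C| * L) := fun K hκ => by
    have hK : 0 < K := by
      rcases Nat.eq_zero_or_pos K with rfl | h
      · norm_num at hκ
      · exact h
    obtain ⟨S, hSf, hSc, hb, hmean⟩ := exists_crofton hΩ hK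
    set κ := 2 * K / Real.pi
    have hle : ENNReal.ofReal (κ - 8) • (μH[1] : Measure Plane).restrict (frontier Ω) ≤ S := by
      refine Measure.le_iff.2 fun B hB => ?_
      rw [Measure.smul_apply, Measure.restrict_apply hB]
      exact ((hb _ inter_subset_right (hB.inter hF)).1).trans (measure_mono inter_subset_left)
    have hae : ∀ᵐ x ∂S, x ∈ frontier Ω := hSc
    have hint : Integrable (fun x => inner ℝ e x) S :=
      Integrable.of_mem_Icc m (m + w) (by fun_prop)
        (hae.mono fun x hx => hm x (hFΩ hx))
    have h1 := integral_mono_measure (f := fun x => inner ℝ e x - m) hle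
      (hae.mono fun x hx => sub_nonneg.2 (hm x (hFΩ hx)).1) (hint.sub (integrable_const m))
    rw [integral_smul_measure, ENNReal.toReal_ofReal (by linarith), ← hX,
      integral_sub hint (integrable_const m), integral_const, smul_eq_mul, smul_eq_mul] at h1
    have h2 := hmean e m w hw hm
    have hu : S.real univ = S.real (frontier Ω) := by
      rw [measureReal_def, measureReal_def, ← measure_add_measure_compl hF, hSc, add_zero]
    obtain ⟨hb1, hb2⟩ := hb _ Subset.rfl hF
    have h3 : (κ - 8) * L ≤ S.real univ := by
      have := ENNReal.toReal_mono (measure_ne_top S _) hb1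
      rwa [ENNReal.toReal_mul, ENNReal.toReal_ofReal (by linarith), ← measureReal_def,
        ← measureReal_def, ← hu] at this
    have h4 : S.real univ ≤ (κ + 8) * L := by
      have := ENNReal.toReal_mono (ENNReal.mul_ne_top ENNReal.ofReal_ne_top
        (hLtop _ Subset.rfl)) hb2
      rwa [ENNReal.toReal_mul, ENNReal.toReal_ofReal (by linarith), ← measureReal_def,
        ← measureReal_def, ← hu] at this
    have h5 : C * (S.real univ - κ * L) ≤ |C| * (8 * L) := by
      calc _ ≤ |C * (S.real univ - κ * L)| := le_abs_self _
        _ = |C| * |S.real univ - κ * L| := abs_mul _ _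
        _ ≤ _ := by
          refine mul_le_mul_of_nonneg_left ?_ (abs_nonneg _)
          rw [abs_le]; constructor <;> linarith
    have h6 : (κ - 8) * X ≤ C * S.real univ := by
      rw [hC]; linarith
    linarith
  have hfin : X ≤ C * L := by
    by_contra! hcon
    have hpos : 0 < X - C * L := sub_pos.2 hcon
    obtain ⟨K, hK⟩ := exists_nat_gt (max 8 (8 * (X + |C| * L) / (X - C * L)) * Real.pi / 2)
    have hlt : max 8 (8 * (X + |C| * L) / (X - C * L)) < 2 * K / Real.pi := by
      rw [lt_div_iff₀ Real.pi_pos]; linarith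
    have h7 := key K ((le_max_left _ _).trans_lt hlt)
    have h8 := (le_max_right _ _).trans_lt hlt
    rw [div_lt_iff₀ hpos] at h8
    linarith
  rw [hXe, hC] at hfin
  linarith

/-- Test with the unit vector e along the difference of the centroids; the width of Ω in direction e
is at most the diameter. -/
lemma norm_boundaryCentroid_sub_bodyCentroid_le {Ω : Set Plane} (hΩ : IsPlanarConvexBody Ω) :
    ‖boundaryCentroid Ω - bodyCentroid Ω‖ ≤ 1 / 6 * Metric.diam Ω := by
  have hd := diam_pos hΩ
  set v := boundaryCentroid Ω - bodyCentroid Ω with hv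
  rcases eq_or_ne v 0 with h0 | h0
  · rw [h0, norm_zero]; positivity
  set e := ‖v‖⁻¹ • v with he
  have he1 : ‖e‖ = 1 := norm_smul_inv_norm h0
  have hev : inner ℝ e v = ‖v‖ := by
    rw [he, real_inner_smul_left, real_inner_self_eq_norm_sq]
    have := norm_pos_iff.2 h0
    field_simp
  have hne : Ω.Nonempty := hΩ.nonempty_interior.mono interior_subset
  obtain ⟨z, hz, hzmin⟩ := hΩ.isCompact.exists_isMinOn hne
    (f := fun x => inner ℝ e x) (by fun_prop)
  have hL := boundaryLength_pos hΩ
  have key := integral_inner_frontier_le hΩ (e := e) (m := inner ℝ e z) hd fun x hx => by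
    refine ⟨hzmin hx, ?_⟩
    have h1 : inner ℝ e (x - z) ≤ ‖e‖ * ‖x - z‖ := real_inner_le_norm _ _
    rw [he1, one_mul, inner_sub_right, ← dist_eq_norm] at h1
    linarith [Metric.dist_le_diam_of_mem hΩ.isCompact.isBounded hx hz]
  have h2 : inner ℝ e (boundaryCentroid Ω) ≤ inner ℝ e (bodyCentroid Ω) + Metric.diam Ω / 6 := by
    rw [inner_boundaryCentroid hΩ, inv_mul_le_iff₀ hL]
    linarith
  rw [← hev, hv, inner_sub_right]
  linarith

/-! ### Sharpness: thin triangles. -/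

/-- The isosceles triangle with apex at the origin, height `1` and base `2 * ε`. -/
def thinTriangle (ε : ℝ) : Set Plane :=
  {x | x 0 ∈ Icc 0 1 ∧ x 1 ∈ Icc (-(ε * x 0)) (ε * x 0)}

/-- The first coordinate vector. -/
noncomputable def horizontal : Plane := !₂[1, 0]

lemma norm_horizontal : ‖horizontal‖ = 1 := by
  rw [norm_eq_one_iff]; simp [horizontal]

lemma inner_horizontal (x : Plane) : inner ℝ horizontal x = x 0 := by
  rw [inner_eq]; simp [horizontal]

lemma frameMap_horizontal (p : ℝ × ℝ) : frameMap horizontal p = !₂[p.1, p.2] := by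
  ext i
  fin_cases i <;> simp [frameMap, horizontal]

lemma isGraphRegion_thinTriangle {ε : ℝ} (hε : 0 < ε) :
    IsGraphRegion (frameMap horizontal ⁻¹' thinTriangle ε) 0 1 (fun t => -(ε * t))
      (fun t => ε * t) where
  lt := one_pos
  concave := ⟨convex_Icc 0 1, fun x _ y _ a b _ _ _ => by
    simp only [smul_eq_mul]; apply le_of_eq; ring⟩
  convex := ⟨convex_Icc 0 1, fun x _ y _ a b _ _ _ => by
    simp only [smul_eq_mul]; apply le_of_eq; ring⟩
  cont_top := by fun_prop
  cont_bot := by fun_prop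
  le t ht := by linarith [mul_nonneg hε.le ht.1]
  lt_of_mem t ht := by linarith [mul_pos hε ht.1]
  mem_iff p := by rw [mem_preimage, frameMap_horizontal]; rfl

lemma thinTriangle_subset_ball {ε : ℝ} (hε : 0 < ε) :
    thinTriangle ε ⊆ Metric.closedBall 0 (1 + ε) := by
  rintro x ⟨⟨h1, h2⟩, h3, h4⟩
  have h5 : ε * x 0 ≤ ε := by nlinarith
  rw [mem_closedBall_zero_iff, EuclideanSpace.norm_eq, Fin.sum_univ_two,
    Real.norm_eq_abs, Real.norm_eq_abs, sq_abs, sq_abs]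
  refine Real.sqrt_le_iff.2 ⟨by linarith, ?_⟩
  nlinarith

lemma isPlanarConvexBody_thinTriangle {ε : ℝ} (hε : 0 < ε) :
    IsPlanarConvexBody (thinTriangle ε) := by
  have h := isGraphRegion_thinTriangle hε
  refine ⟨?_, ?_, ?_⟩
  · refine (isCompact_closedBall (0 : Plane) (1 + ε)).of_isClosed_subset ?_
      (thinTriangle_subset_ball hε)
    rw [← (frameHomeomorph norm_horizontal).isClosed_preimage]
    exact h.isClosed
  · rintro x ⟨⟨h1, h2⟩, h3, h4⟩ y ⟨⟨h1', h2'⟩, h3', h4'⟩ a b ha hb hab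
    simp only [thinTriangle, mem_ofPred_eq, PiLp.add_apply, PiLp.smul_apply, smul_eq_mul, mem_Icc]
    refine ⟨⟨by positivity, by nlinarith⟩, ?_, ?_⟩
    · nlinarith [mul_le_mul_of_nonneg_left h3 ha, mul_le_mul_of_nonneg_left h3' hb]
    · nlinarith [mul_le_mul_of_nonneg_left h4 ha, mul_le_mul_of_nonneg_left h4' hb]
  · have := (frameHomeomorph norm_horizontal).preimage_interior (thinTriangle ε)
    refine ⟨frameMap horizontal (1 / 2, 0), ?_⟩
    change ((1 / 2, 0) : ℝ × ℝ) ∈ frameHomeomorph norm_horizontal ⁻¹' interior (thinTriangle ε)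
    rw [this]
    exact h.mem_interior (by constructor <;> norm_num) (by simpa using hε) (by simpa using hε)

lemma bodyCentroid_thinTriangle {ε : ℝ} (hε : 0 < ε) :
    inner ℝ horizontal (bodyCentroid (thinTriangle ε)) = 2 / 3 := by
  have h := isGraphRegion_thinTriangle hε
  have hc := (isPlanarConvexBody_thinTriangle hε).isCompact
  have h1 := inner_bodyCentroid_mul norm_horizontal hc h horizontal
  have h2 := volume_body norm_horizontal hc h
  have e1 : ∫ t in (0 : ℝ)..1, (ε * t - -(ε * t)) = ε := by
    have : (fun t => ε * t - -(ε * t)) = fun t => 2 * ε * t := by ext t; ring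
    rw [this, intervalIntegral.integral_const_mul, integral_id]; ring
  rw [h2, e1, real_inner_self_eq_norm_sq, norm_horizontal, inner_rot_self] at h1
  have e2 : ∫ t in (0 : ℝ)..1, ((1 : ℝ) ^ 2 * t * (ε * t - -(ε * t)) +
      0 * ((ε * t) ^ 2 - (-(ε * t)) ^ 2) / 2) = 2 / 3 * ε := by
    have : (fun t => (1 : ℝ) ^ 2 * t * (ε * t - -(ε * t)) +
      0 * ((ε * t) ^ 2 - (-(ε * t)) ^ 2) / 2) = fun t => 2 * ε * t ^ 2 := by ext t; ring
    rw [this, intervalIntegral.integral_const_mul, integral_pow]; norm_num; ring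
  rw [e2] at h1
  exact mul_right_cancel₀ hε.ne' h1

lemma dist_le_abs_add_abs (x y : Plane) : dist x y ≤ |x 0 - y 0| + |x 1 - y 1| := by
  rw [EuclideanSpace.dist_eq, Fin.sum_univ_two, Real.dist_eq, Real.dist_eq]
  refine Real.sqrt_le_iff.2 ⟨by positivity, ?_⟩
  nlinarith [mul_nonneg (abs_nonneg (x 0 - y 0)) (abs_nonneg (x 1 - y 1))]

lemma diam_thinTriangle_le {ε : ℝ} (hε : 0 < ε) : Metric.diam (thinTriangle ε) ≤ 1 + 2 * ε := by
  refine Metric.diam_le_of_forall_dist_le (by positivity) ?_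
  rintro x ⟨⟨h1, h2⟩, h3, h4⟩ y ⟨⟨h1', h2'⟩, h3', h4'⟩
  have h5 : ε * x 0 ≤ ε := by nlinarith
  have h5' : ε * y 0 ≤ ε := by nlinarith
  refine (dist_le_abs_add_abs x y).trans (add_le_add ?_ ?_) <;> rw [abs_le] <;> constructor <;>
    linarith

lemma mem_segment_of_coord {x y z : Plane} {s : ℝ} (hs : s ∈ Icc (0 : ℝ) 1)
    (h0 : z 0 = (1 - s) * x 0 + s * y 0) (h1 : z 1 = (1 - s) * x 1 + s * y 1) :
    z ∈ segment ℝ x y := by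
  refine ⟨1 - s, s, sub_nonneg.2 hs.2, hs.1, by ring, ?_⟩
  ext i
  fin_cases i
  · simp [h0]
  · simp [h1]

lemma frontier_thinTriangle_subset {ε : ℝ} (hε : 0 < ε) :
    frontier (thinTriangle ε) ⊆ segment ℝ 0 !₂[1, ε] ∪ segment ℝ 0 !₂[1, -ε] ∪
      segment ℝ !₂[1, -ε] !₂[1, ε] := by
  have h := isGraphRegion_thinTriangle hε
  intro x hx
  obtain ⟨⟨h1, h2⟩, h3, h4⟩ :=
    (isPlanarConvexBody_thinTriangle hε).isCompact.isClosed.frontier_subset hx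
  rcases h1.eq_or_lt with h1 | h1
  · left; left
    rw [← h1] at h3 h4
    exact mem_segment_of_coord (s := 0) (by simp) (by simp [← h1]) (by simp; linarith)
  rcases h2.eq_or_lt with h2 | h2
  · right
    rw [h2, mul_one] at h3 h4
    refine mem_segment_of_coord (s := (x 1 + ε) / (2 * ε))
      ⟨div_nonneg (by linarith) (by linarith), ?_⟩ ?_ ?_
    · rw [div_le_one (by linarith)]; linarith
    · simp [h2]
    · simp; field_simp; ring
  · have e := frameMap_inner norm_horizontal x
    rw [← e] at hx
    have hx' := (mem_frontier_frameMap_iff norm_horizontal h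
      (by rw [inner_horizontal]; exact ⟨h1, h2⟩)).1 hx
    have hr : inner ℝ (rot horizontal) x = x 1 := by
      rw [inner_eq]; simp [horizontal]
    dsimp only at hx'
    rw [inner_horizontal, hr] at hx'
    left
    rcases hx' with hx' | hx'
    · right
      exact mem_segment_of_coord (s := x 0) ⟨h1.le, h2.le⟩ (by simp) (by simp [hx', mul_comm])
    · left
      exact mem_segment_of_coord (s := x 0) ⟨h1.le, h2.le⟩ (by simp) (by simp [hx', mul_comm])

lemma hausdorffMeasure_segment_le (x y : Plane) :
    μH[1] (segment ℝ x y) ≤ ENNReal.ofReal (|x 0 - y 0| + |x 1 - y 1|) := by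
  rw [hausdorffMeasure_segment, edist_dist]
  exact ENNReal.ofReal_le_ofReal (dist_le_abs_add_abs x y)

lemma boundaryLength_thinTriangle_le {ε : ℝ} (hε : 0 < ε) :
    boundaryLength (thinTriangle ε) ≤ 2 + 4 * ε := by
  have h1 : (μH[1] : Measure Plane) (segment ℝ 0 !₂[1, ε]) ≤ ENNReal.ofReal (1 + ε) := by
    simpa [abs_of_pos hε] using hausdorffMeasure_segment_le 0 !₂[1, ε]
  have h2 : (μH[1] : Measure Plane) (segment ℝ 0 !₂[1, -ε]) ≤ ENNReal.ofReal (1 + ε) := by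
    simpa [abs_of_pos hε] using hausdorffMeasure_segment_le 0 !₂[1, -ε]
  have h3 : (μH[1] : Measure Plane) (segment ℝ !₂[1, -ε] !₂[1, ε]) ≤ ENNReal.ofReal (2 * ε) := by
    refine (hausdorffMeasure_segment_le _ _).trans (ENNReal.ofReal_le_ofReal ?_)
    simp only [Matrix.cons_val_zero, Matrix.cons_val_one, sub_self, abs_zero,
      zero_add]
    rw [abs_le]; constructor <;> linarith
  refine ENNReal.toReal_le_of_le_ofReal (by positivity) ?_
  calc (μH[1] : Measure Plane) (frontier (thinTriangle ε))
      ≤ ENNReal.ofReal (1 + ε) + ENNReal.ofReal (1 + ε) + ENNReal.ofReal (2 * ε) :=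
        (measure_mono (frontier_thinTriangle_subset hε)).trans ((measure_union_le _ _).trans
          (add_le_add ((measure_union_le _ _).trans (add_le_add h1 h2)) h3))
    _ = ENNReal.ofReal (2 + 4 * ε) := by
      rw [← ENNReal.ofReal_add (by positivity) (by positivity),
        ← ENNReal.ofReal_add (by positivity) (by positivity)]
      congr 1; ring

/-- Arc length dominates the horizontal chord measure, for which the nonnegative function 1 - x₀ has
integral 1. So the arc-length mean of 1 - x₀ is at least 1/length, and the base and slanted sides
need not be integrated. -/
lemma boundaryCentroid_thinTriangle_le {ε : ℝ} (hε : 0 < ε) :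
    inner ℝ horizontal (boundaryCentroid (thinTriangle ε)) ≤ 1 - 1 / (2 + 4 * ε) := by
  have hΩ := isPlanarConvexBody_thinTriangle hε
  have hFΩ := hΩ.isCompact.isClosed.frontier_subset
  have h := isGraphRegion_thinTriangle hε
  have hν := isChordMeasure_chordMeasure norm_horizontal hΩ.isCompact h
  have hL := boundaryLength_pos hΩ
  have := isFiniteMeasure_boundary hΩ
  have h1 := integral_mono_measure (f := fun x => 1 - inner ℝ horizontal x)
    (hν.le_restrict hΩ norm_horizontal)
    ((ae_restrict_mem isClosed_frontier.measurableSet).mono fun x hx => by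
      change 0 ≤ 1 - inner ℝ horizontal x
      rw [inner_horizontal]
      exact sub_nonneg.2 (hFΩ hx).1.2)
    (integrableOn_frontier hΩ (by fun_prop))
  have h2 : ∫ x, (1 - inner ℝ horizontal x) ∂(chordMeasure horizontal 0 1 (fun t => -(ε * t))
      fun t => ε * t) = 1 := by
    rw [integral_chordMeasure h (by fun_prop)]
    simp only [inner_self_frameMap norm_horizontal]
    have : (fun t : ℝ => 1 - t + (1 - t)) = fun t => 2 + (-2) * t := by ext t; ring
    rw [this, integral_affine]; norm_num
  rw [h2, integral_sub (integrable_const _) (integrableOn_frontier hΩ (by fun_prop))] at h1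
  have h3 : ∫ _x in frontier (thinTriangle ε), (1 : ℝ) ∂(μH[1] : Measure Plane) =
      boundaryLength (thinTriangle ε) := by
    simp [measureReal_def, boundaryLength]
  rw [h3] at h1
  rw [inner_boundaryCentroid hΩ, inv_mul_le_iff₀ hL, mul_sub, mul_one]
  have h4 : boundaryLength (thinTriangle ε) * (1 / (2 + 4 * ε)) ≤ 1 := by
    rw [mul_one_div, div_le_one (by positivity)]
    exact boundaryLength_thinTriangle_le hε
  linarith

lemma le_norm_centroid_sub_thinTriangle {ε : ℝ} (hε : 0 < ε) :
    1 / (2 + 4 * ε) - 1 / 3 ≤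
      ‖boundaryCentroid (thinTriangle ε) - bodyCentroid (thinTriangle ε)‖ := by
  have h1 := abs_real_inner_le_norm horizontal
    (boundaryCentroid (thinTriangle ε) - bodyCentroid (thinTriangle ε))
  rw [norm_horizontal, one_mul, inner_sub_right, bodyCentroid_thinTriangle hε] at h1
  linarith [boundaryCentroid_thinTriangle_le hε, (abs_le.1 h1).1]

/-- The bounds for diameter and perimeter are 1 + 2ε and twice that, so one triangle serves both
claims. As ε → 0 the centroid distance is bounded below by a quantity tending to 1/2 - 1/3 = 1/6. -/
lemma exists_body_of_lt {k : ℝ} (hk : k < 1 / 6) :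
    ∃ Ω : Set Plane, IsPlanarConvexBody Ω ∧
      k * Metric.diam Ω < ‖boundaryCentroid Ω - bodyCentroid Ω‖ ∧
      k / 2 * boundaryLength Ω < ‖boundaryCentroid Ω - bodyCentroid Ω‖ := by
  -- Replacing k by max k 0 allows multiplication by the upper bounds for diameter and perimeter
  -- when k is negative.
  have h1 : Tendsto (fun ε : ℝ => 1 / (2 + 4 * ε) - 1 / 3 - max k 0 * (1 + 2 * ε)) (𝓝[>] 0)
      (𝓝 (1 / (2 + 4 * 0) - 1 / 3 - max k 0 * (1 + 2 * 0))) := by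
    refine Tendsto.mono_left (ContinuousAt.tendsto ?_) nhdsWithin_le_nhds
    refine ContinuousAt.sub (ContinuousAt.sub (ContinuousAt.div ?_ ?_ ?_) ?_) ?_ <;>
      first | fun_prop | norm_num
  have h2 : 0 < 1 / (2 + 4 * 0) - 1 / 3 - max k 0 * (1 + 2 * 0) := by
    have := max_lt hk (by norm_num : (0 : ℝ) < 1 / 6)
    norm_num at this ⊢
    exact this
  obtain ⟨ε, hlt, hε⟩ := ((h1.eventually (lt_mem_nhds h2)).and self_mem_nhdsWithin).exists
  have hε' : 0 < ε := hε
  have hc := le_norm_centroid_sub_thinTriangle hε'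
  have h3 : max k 0 * (1 + 2 * ε) < 1 / (2 + 4 * ε) - 1 / 3 := by linarith
  refine ⟨thinTriangle ε, isPlanarConvexBody_thinTriangle hε', ?_, ?_⟩
  · refine lt_of_le_of_lt ?_ (h3.trans_le hc)
    exact mul_le_mul (le_max_left _ _) (diam_thinTriangle_le hε') Metric.diam_nonneg
      (le_max_right _ _)
  · refine lt_of_le_of_lt ?_ (h3.trans_le hc)
    have h4 : k * boundaryLength (thinTriangle ε) ≤ max k 0 * (2 + 4 * ε) :=
      mul_le_mul (le_max_left _ _) (boundaryLength_thinTriangle_le hε') measureReal_nonneg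
        (le_max_right _ _)
    linarith

end PlanarCentroid

theorem mainTheorem2 :
    (∀ Ω : Set (EuclideanSpace ℝ (Fin 2)), IsPlanarConvexBody Ω →
      ‖boundaryCentroid Ω - bodyCentroid Ω‖ ≤ (1 / 6 : ℝ) * Metric.diam Ω ∧
      (1 / 6 : ℝ) * Metric.diam Ω ≤ (1 / 12 : ℝ) * boundaryLength Ω) ∧
    (∀ k : ℝ, k < 1 / 6 → ∃ Ω : Set (EuclideanSpace ℝ (Fin 2)), IsPlanarConvexBody Ω ∧
      k * Metric.diam Ω < ‖boundaryCentroid Ω - bodyCentroid Ω‖) ∧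
    (∀ k : ℝ, k < 1 / 12 → ∃ Ω : Set (EuclideanSpace ℝ (Fin 2)), IsPlanarConvexBody Ω ∧
      k * boundaryLength Ω < ‖boundaryCentroid Ω - bodyCentroid Ω‖) := by
  refine ⟨fun Ω hΩ => ⟨PlanarCentroid.norm_boundaryCentroid_sub_bodyCentroid_le hΩ, ?_⟩,
    fun k hk => ?_, fun k hk => ?_⟩
  · linarith [PlanarCentroid.two_mul_diam_le_boundaryLength hΩ]
  · obtain ⟨Ω, hΩ, h, -⟩ := PlanarCentroid.exists_body_of_lt hk
    exact ⟨Ω, hΩ, h⟩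
  · obtain ⟨Ω, hΩ, -, h⟩ := PlanarCentroid.exists_body_of_lt (k := 2 * k) (by linarith)
    refine ⟨Ω, hΩ, ?_⟩
    rwa [mul_div_cancel_left₀ _ two_ne_zero] at h
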